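/- Conventions. For a spin $j\in\{0,\tfrac12,1,\dots\}$ let $V_j$ be the irreducible representation of $\mathrm{SU}(2)$ of dimension $2j+1$, realized as the homogeneous polynomials of degree $2j$ in two variables. It carries the invariant bilinear form with $\langle u^{2j},v^{2j}\rangle=\varepsilon(u,v)^{2j}$ for linear forms $u,v$, where $\varepsilon$ is the invariant symplectic form with $\varepsilon(x,y)=1$; edges of spin networks are contracted with it. Spins $j_1,j_2,j_3$ are an admissible triple if they satisfy the triangle inequality and have integer sum. The trivalent vertex of an admissible triple is the invariant tensor in $V_{j_1}\otimes V_{j_2}\otimes V_{j_3}$ given by $$\theta(j_1,j_2,j_3)^{-1/2}\,[12]^{j_1+j_2-j_3}[23]^{j_2+j_3-j_1}[31]^{j_3+j_1-j_2},\qquad [pq]=x_py_q-y_px_q,$$ where $\theta(j_1,j_2,j_3)$ is the value of the planar theta graph whose two vertices are the product of brackets and its mirror image (the same product for the reversed cyclic order of the legs), with all three edges directed from the first to the second vertex, so that the theta graph with normalized vertices has value $1$; its sign is that of $(-1)^{j_1+j_2+j_3}$. The trivalent vertex is $0$ for other triples. For four legs with spins $j_1,\dots,j_4$ split into pairs $\{1,2\}$,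 $\{3,4\}$, let $Y_j$ be the $\mathrm{SU}(2)$ intertwiner that joins a trivalent vertex with spins $j_1,j_2,j$ to one with spins $j,j_3,j_4$ along an edge of spin $j$. The Barrett--Crane intertwiner is $\sum_j(-1)^{2j}(2j+1)\,Y_j\otimes Y_j$ and the modified Barrett--Crane intertwiner is $\sum_j(2j+1)\,Y_j\otimes Y_j$, where $j$ runs over the spins for which $j_1,j_2,j$ and $j_3,j_4,j$ are admissible; both are tensors on the representations $V_{j_i}\otimes V_{j_i}$ of $\mathrm{SU}(2)\times\mathrm{SU}(2)$. In both, the same choice of square roots is used in the two factors of $Y_j\otimes Y_j$, so that it does not matter. Consider the complete graph on the vertex set $\mathbb Z/5$, drawn as a pentagon (numbered counterclockwise) with its inscribed pentagram, and label its ten edges by spins $j_1,\dots,j_{10}$. The Riemannian $10j$ symbol $A$ is the value of the closed $\mathrm{SU}(2)\times\mathrm{SU}(2)$ spin network with the edge of spin $j$ labelled by $V_j\otimes V_j$ and with the Barrett--Crane intertwiner at each vertex, where at each vertex any splitting of the four edges into two pairs may be used to write it down. The modified $10j$ symbol $\widetilde A$ is the value of the same network with the modified Barrett--Crane intertwiner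 at each vertex, where the edges at the vertex $i$ are split into those to $i+1,i+2$ and those to $i-1,i-2$. Lemma. For all spins $j_1,\dots,j_{10}$, and for every choice of the splittings used to write down the Barrett--Crane intertwiners in $A$, $$A=(-1)^{2(j_1+\cdots+j_{10})}\,\widetilde A .$$ It follows that when $A$ is nonzero, it is a real number that is positive if $j_1+\cdots+j_{10}$ is an integer and negative if $j_1+\cdots+j_{10}$ is a half-integer (an integer plus $\tfrac12$). -/

import Mathlib

/-!
Spin networks for `SU(2)` and `SU(2) × SU(2)`, in components.

A spin `j` is encoded by the natural number `n = 2j`.  The irreducible representation of spin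
`j` is the space of homogeneous polynomials of degree `n` in two variables `x, y`, with basis
`e_a = x ^ a * y ^ (n - a)`, `a = 0, …, n`.  An invariant tensor is given by its components in
these bases; two legs of the same spin are joined with the invariant bilinear form.
-/

open scoped BigOperators

noncomputable section

namespace SpinNetwork

/-- The spin `j = n / 2` encoded by the natural number `n`. -/
def spin (n : ℕ) : ℚ := (n : ℚ) / 2

/-- The `SU(2)`-invariant bilinear form on the representation of spin `n / 2`, evaluated on
`e_a, e_b`.  It is the form with `⟨u ^ n, v ^ n⟩ = (ε(u, v)) ^ n` for linear forms `u, v`, where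
`ε` is the invariant symplectic form with `ε(x, y) = 1`; it is symmetric or antisymmetric
according to the parity of `n`. -/
def form (n a b : ℕ) : ℂ :=
  if a + b = n then (-1) ^ b / (n.choose a : ℂ) else 0

/-- The spins `a / 2, b / 2, c / 2` form an admissible triple: they satisfy the triangle
inequality and their sum is an integer. -/
def Admissible (a b c : ℕ) : Prop :=
  a ≤ b + c ∧ b ≤ a + c ∧ c ≤ a + b ∧ Even (a + b + c)

/-- The invariant bracket `[p q] = x_p y_q - y_p x_q`, where `X (p, 0) = x_p` and
`X (p, 1) = y_p` are the variables of the `p`-th leg. -/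
def bracket (p q : Fin 3) : MvPolynomial (Fin 3 × Fin 2) ℂ :=
  MvPolynomial.X (p, 0) * MvPolynomial.X (q, 1) - MvPolynomial.X (p, 1) * MvPolynomial.X (q, 0)

/-- The unnormalized trivalent vertex with legs of spins `a / 2, b / 2, c / 2` in this cyclic
order: `(a + b - c) / 2` strands join the first two legs, and so on. -/
def vertexPoly (a b c : ℕ) : MvPolynomial (Fin 3 × Fin 2) ℂ :=
  bracket 0 1 ^ ((a + b - c) / 2) * bracket 1 2 ^ ((b + c - a) / 2) *
    bracket 2 0 ^ ((c + a - b) / 2)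

/-- The exponent of the monomial `∏ p, x_p ^ α p * y_p ^ (n p - α p)`. -/
def exponent (n α : Fin 3 → ℕ) : Fin 3 × Fin 2 →₀ ℕ :=
  Finsupp.equivFunOnFinite.symm fun s => if s.2 = 0 then α s.1 else n s.1 - α s.1

open Classical in
/-- The components of the unnormalized trivalent vertex; it is zero if the spins do not form
an admissible triple. -/
def rawVertex (a b c : ℕ) (α β γ : ℕ) : ℂ :=
  if Admissible a b c then (vertexPoly a b c).coeff (exponent ![a, b, c] ![α, β, γ]) else 0

/-- The value of the theta graph built from unnormalized vertices.  In the planar graph the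
three edges leave the two vertices in opposite cyclic orders. -/
def theta (a b c : ℕ) : ℂ :=
  ∑ α ∈ Finset.range (a + 1), ∑ β ∈ Finset.range (b + 1), ∑ γ ∈ Finset.range (c + 1),
  ∑ α' ∈ Finset.range (a + 1), ∑ β' ∈ Finset.range (b + 1), ∑ γ' ∈ Finset.range (c + 1),
    rawVertex a b c α β γ * rawVertex c b a γ' β' α' *
      (form a α α' * form b β β' * form c γ γ')

/-- The trivalent vertex normalized so that the theta graph has value `1`.  The square root of
`theta` may be imaginary; which of the two roots is taken does not matter below, because every
vertex occurs twice with the same spins in the same product. -/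
def vertex (a b c : ℕ) (α β γ : ℕ) : ℂ :=
  rawVertex a b c α β γ / (theta a b c) ^ (1 / 2 : ℂ)

/-- The `SU(2)` intertwiner with external legs of spins `m 0 / 2, …, m 3 / 2` (with indices `x`),
made of two trivalent vertices joined by an edge of spin `k / 2`: the legs `0, 1` are at the
first vertex and the legs `2, 3` at the second one. -/
def doubleY (m : Fin 4 → ℕ) (k : ℕ) (x : Fin 4 → ℕ) : ℂ :=
  ∑ c ∈ Finset.range (k + 1), ∑ d ∈ Finset.range (k + 1),
    vertex (m 0) (m 1) k (x 0) (x 1) c * form k c d * vertex k (m 2) (m 3) d (x 2) (x 3)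

open Classical in
/-- The (doubled) intermediate spins that are admissible for the splitting `{0, 1}, {2, 3}`
of four legs. -/
def internalSpins (m : Fin 4 → ℕ) : Finset ℕ :=
  (Finset.range (m 0 + m 1 + 1)).filter fun k =>
    Admissible (m 0) (m 1) k ∧ Admissible (m 2) (m 3) k

/-- The components of an `SU(2) × SU(2)` tensor with four legs, the leg `l` carrying the
representation `j ⊗ j`: the two arguments are the indices of the left and right factors. -/
abbrev Tensor : Type := (Fin 4 → ℕ) → (Fin 4 → ℕ) → ℂ

/-- The Barrett--Crane intertwiner for four legs of spins `m l / 2`, computed with the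
splitting of the legs into the pairs `{σ 0, σ 1}` and `{σ 2, σ 3}`:
`∑ j, (-1) ^ (2 j) (2 j + 1) Y_j ⊗ Y_j`. -/
def barrettCrane (σ : Equiv.Perm (Fin 4)) (m : Fin 4 → ℕ) : Tensor := fun x x' =>
  ∑ k ∈ internalSpins (m ∘ σ), (-1) ^ k * ((k : ℂ) + 1) *
    (doubleY (m ∘ σ) k (x ∘ σ) * doubleY (m ∘ σ) k (x' ∘ σ))

/-- The modified Barrett--Crane intertwiner for the splitting of the legs into the pairs
`{σ 0, σ 1}` and `{σ 2, σ 3}`: `∑ j, (2 j + 1) Y_j ⊗ Y_j`. -/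
def modifiedBarrettCrane (σ : Equiv.Perm (Fin 4)) (m : Fin 4 → ℕ) : Tensor := fun x x' =>
  ∑ k ∈ internalSpins (m ∘ σ), ((k : ℂ) + 1) *
    (doubleY (m ∘ σ) k (x ∘ σ) * doubleY (m ∘ σ) k (x' ∘ σ))

/-- The ten edges of the complete graph on `ZMod 5`, drawn as a pentagon (numbered
counterclockwise) with its pentagram: `(i, 0)` goes from `i` to `i + 1` and `(i, 1)` goes
from `i` to `i + 2`. -/
abbrev Edge : Type := ZMod 5 × Fin 2

/-- Given labels `t e` at the tails and `h e` at the heads of the edges `e`, the labels of the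
four legs at the vertex `i`, in the cyclic order of the drawing: the legs towards
`i + 1`, `i + 2`, `i - 2`, `i - 1`. -/
def legs (t h : Edge → ℕ) (i : ZMod 5) : Fin 4 → ℕ :=
  ![t (i, 0), t (i, 1), h (i - 2, 1), h (i - 1, 0)]

/-- The value of the closed `SU(2) × SU(2)` spin network on the complete graph with five
vertices, with edges labelled by `j ⊗ j`, `j = n e / 2`, and with the tensor `B i` at the
vertex `i`.  The form on `j ⊗ j` is symmetric, so the orientation of the edges is irrelevant. -/
def evaluate (n : Edge → ℕ) (B : ZMod 5 → Tensor) : ℂ :=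
  let I : Finset (Edge → ℕ) := Fintype.piFinset fun e => Finset.range (n e + 1)
  ∑ t ∈ I, ∑ h ∈ I, ∑ t' ∈ I, ∑ h' ∈ I,
    (∏ e, form (n e) (t e) (h e) * form (n e) (t' e) (h' e)) *
      ∏ i, B i (legs t h i) (legs t' h' i)

/-- The Riemannian `10j` symbol.  The splitting `σ i` is the one used to write down the
Barrett--Crane intertwiner at the vertex `i`. -/
def tenJ (σ : ZMod 5 → Equiv.Perm (Fin 4)) (n : Edge → ℕ) : ℂ :=
  evaluate n fun i => barrettCrane (σ i) (legs n n i)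

/-- The modified `10j` symbol: at each vertex `i` the modified Barrett--Crane intertwiner for
the splitting of the legs into those towards `i + 1`, `i + 2` and those towards
`i - 1`, `i - 2`. -/
def modifiedTenJ (n : Edge → ℕ) : ℂ :=
  evaluate n fun i => modifiedBarrettCrane 1 (legs n n i)

end SpinNetwork

end

/-! For a fixed splitting, the intertwiners `Y_k` are an orthogonal basis of the invariant tensors
with four legs for the invariant bilinear pairing. By `pairing_splitY_self`, the pairing of `Y_k`
with itself is `(-1) ^ (J + k) / (k + 1)`, where `J` is the sum of the four external spins. Up to
the sign `(-1) ^ J`, which ignores the splitting, the Barrett--Crane intertwiner is therefore the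
inverse of the pairing and cannot depend on the splitting (`barrettCrane_eq`).

For the splitting into edges leaving `i` and edges entering `i`, admissibility fixes the parity of
`k` to be that of the sum of the two outgoing labels. The sign `(-1) ^ k` thus comes out of the sum
(`barrettCrane_one_eq`). Each edge leaves exactly one vertex, so the five signs multiply to `(-1) ^
(∑ e, n e)`, and `tenJ_eq` follows.

For positivity, fixing the five intermediate spins separates the left and right `SU(2)` factors, and
`modifiedTenJ_eq` writes the modified symbol as a positive combination of squares of networks. Such
a network is a real number divided by square roots of theta graphs. The signs of the ten theta
graphs multiply to `1`, so each square is nonnegative (`exists_network_sq`).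

The basis property rests on Clebsch--Gordan theory done by hand. Vertices are killed by the raising
and Cartan operators of `sl₂`; these two alone give Schur's lemma for tensors with two legs
(`eq_zero_of_isInvariant`, `exists_eq_smul_pairMatrix`). Orthogonality together with a dimension
count gives completeness (`IsCoupling.completeness`). -/

noncomputable section

namespace SpinNetwork

/-! ### The polynomial vertex -/

/-- The raising operator of `sl₂` in the coordinates of the representation of spin `n / 2`. -/
def raising (n i j : ℕ) : ℂ := if i = j + 1 then (n : ℂ) - j else 0

/-- The Cartan operator of `sl₂` in the coordinates of the representation of spin `n / 2`. -/
def cartan (n i j : ℕ) : ℂ := if i = j then 2 * (i : ℂ) - n else 0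

lemma sum_raising {n i : ℕ} (hi : i ≤ n) (f : ℕ → ℂ) :
    ∑ j ∈ Finset.range (n + 1), raising n i j * f j =
      if i = 0 then 0 else ((n - i : ℕ) + 1 : ℂ) * f (i - 1) := by
  rcases i with _ | i
  · simp [raising]
  · rw [Finset.sum_eq_single i]
    · have : ((n - (i + 1) : ℕ) : ℂ) = n - (i + 1) := by push_cast [Nat.cast_sub hi]; ring
      simp only [raising, if_true, if_neg (Nat.succ_ne_zero i), this, Nat.add_sub_cancel]
      ring
    · intro j _ hj
      simp [raising, Ne.symm hj]
    · intro h
      exact absurd (Finset.mem_range.2 (by omega)) h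

lemma sum_cartan {n i : ℕ} (hi : i ≤ n) (f : ℕ → ℂ) :
    ∑ j ∈ Finset.range (n + 1), cartan n i j * f j = (2 * (i : ℂ) - n) * f i := by
  rw [Finset.sum_eq_single i]
  · simp [cartan]
  · intro j _ hj
    simp [cartan, Ne.symm hj]
  · intro h
    exact absurd (Finset.mem_range.2 (by omega)) h

/-- The raising operator as a derivation of the polynomials in the variables of three legs. -/
def raisingDerivation :
    Derivation ℂ (MvPolynomial (Fin 3 × Fin 2) ℂ) (MvPolynomial (Fin 3 × Fin 2) ℂ) :=
  ∑ p : Fin 3, (MvPolynomial.X (p, 0) : MvPolynomial (Fin 3 × Fin 2) ℂ) •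
    MvPolynomial.pderiv (p, (1 : Fin 2))

lemma raisingDerivation_apply (P : MvPolynomial (Fin 3 × Fin 2) ℂ) :
    raisingDerivation P =
      ∑ p : Fin 3, MvPolynomial.X (p, 0) * MvPolynomial.pderiv (p, (1 : Fin 2)) P := by
  simp [raisingDerivation, Fin.sum_univ_three]

/-- The derivation sends each `y_p` to `x_p` and kills each `x_p`, so the two terms of the bracket
both give `x_p x_q` and cancel. -/
lemma raisingDerivation_bracket (p q : Fin 3) : raisingDerivation (bracket p q) = 0 := by
  have h0 (p : Fin 3) : raisingDerivation (MvPolynomial.X (p, 0)) = 0 := by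
    rw [raisingDerivation_apply]
    refine Finset.sum_eq_zero fun q _ => ?_
    rw [MvPolynomial.pderiv_X_of_ne (by simp), mul_zero]
  have h1 (p : Fin 3) : raisingDerivation (MvPolynomial.X (p, 1)) = MvPolynomial.X (p, 0) := by
    rw [raisingDerivation_apply, Finset.sum_eq_single p]
    · simp
    · intro q _ hq
      rw [MvPolynomial.pderiv_X_of_ne (by simpa using Ne.symm hq), mul_zero]
    · simp
  rw [bracket, map_sub, Derivation.leibniz, Derivation.leibniz, h0, h0, h1, h1]
  simp only [smul_eq_mul]
  ring

lemma raisingDerivation_vertexPoly (a b c : ℕ) : raisingDerivation (vertexPoly a b c) = 0 := by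
  simp [vertexPoly, Derivation.leibniz, Derivation.leibniz_pow, raisingDerivation_bracket]

lemma exponent_apply_zero (n α : Fin 3 → ℕ) (p : Fin 3) : exponent n α (p, 0) = α p := by
  simp [exponent]

lemma exponent_apply_one (n α : Fin 3 → ℕ) (p : Fin 3) :
    exponent n α (p, 1) = n p - α p := by
  simp [exponent]

lemma exponent_shift {n α : Fin 3 → ℕ} {p : Fin 3} (h : α p ≤ n p) (h0 : α p ≠ 0) :
    exponent n α - Finsupp.single (p, 0) 1 + Finsupp.single (p, 1) 1 =
      exponent n (Function.update α p (α p - 1)) := by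
  ext ⟨q, i⟩
  by_cases hq : p = q
  · subst hq
    fin_cases i
    · simp [exponent]
    · simp [exponent]; omega
  · fin_cases i <;> simp [exponent, Ne.symm hq]

lemma coeff_X_mul_pderiv {n α : Fin 3 → ℕ} {p : Fin 3} (h : α p ≤ n p)
    (P : MvPolynomial (Fin 3 × Fin 2) ℂ) :
    (MvPolynomial.X (p, 0) * MvPolynomial.pderiv (p, (1 : Fin 2)) P).coeff (exponent n α) =
      if α p = 0 then 0 else ((n p - α p : ℕ) + 1 : ℂ) *
        P.coeff (exponent n (Function.update α p (α p - 1))) := by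
  classical
  rw [MvPolynomial.coeff_X_mul']
  by_cases h0 : α p = 0
  · simp [h0, exponent_apply_zero]
  · rw [if_pos (by simpa [exponent_apply_zero] using h0), if_neg h0, MvPolynomial.coeff_pderiv,
      exponent_shift h h0]
    simp [exponent_apply_one, mul_comm]

/-- A tensor with three legs is annihilated by the operator with components `D`. -/
def Annihilates₃ (D : ℕ → ℕ → ℕ → ℂ) (a b c : ℕ) (v : ℕ → ℕ → ℕ → ℂ) : Prop :=
  ∀ α ≤ a, ∀ β ≤ b, ∀ γ ≤ c,
    ∑ j ∈ Finset.range (a + 1), D a α j * v j β γ +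
    ∑ j ∈ Finset.range (b + 1), D b β j * v α j γ +
    ∑ j ∈ Finset.range (c + 1), D c γ j * v α β j = 0

lemma Annihilates₃.div {D : ℕ → ℕ → ℕ → ℂ} {a b c : ℕ} {v : ℕ → ℕ → ℕ → ℂ}
    (h : Annihilates₃ D a b c v) (s : ℂ) :
    Annihilates₃ D a b c fun α β γ => v α β γ / s := by
  intro α hα β hβ γ hγ
  have := h α hα β hβ γ hγ
  simp only [← mul_div_assoc, ← Finset.sum_div]
  rw [← add_div, ← add_div, this, zero_div]

/-- The derivation kills a product of brackets; reading off one coefficient of this polynomial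
identity gives the componentwise statement. -/
lemma raising_rawVertex (a b c : ℕ) : Annihilates₃ raising a b c (rawVertex a b c) := by
  intro α hα β hβ γ hγ
  rw [sum_raising hα, sum_raising hβ (fun j => rawVertex a b c α j γ), sum_raising hγ]
  by_cases had : Admissible a b c
  · have h := congrArg (MvPolynomial.coeff (exponent ![a, b, c] ![α, β, γ]))
      (raisingDerivation_vertexPoly a b c)
    have u0 (j : ℕ) : Function.update ![α, β, γ] 0 j = ![j, β, γ] := by
      ext i; fin_cases i <;> simp
    have u1 (j : ℕ) : Function.update ![α, β, γ] 1 j = ![α, j, γ] := by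
      ext i; fin_cases i <;> simp
    have u2 (j : ℕ) : Function.update ![α, β, γ] 2 j = ![α, β, j] := by
      ext i; fin_cases i <;> simp
    rw [raisingDerivation_apply, Fin.sum_univ_three, MvPolynomial.coeff_add,
      MvPolynomial.coeff_add, coeff_X_mul_pderiv (by simpa using hα),
      coeff_X_mul_pderiv (by simpa using hβ), coeff_X_mul_pderiv (by simpa using hγ),
      u0, u1, u2] at h
    simp only [rawVertex, if_pos had]
    exact h
  · simp [rawVertex, had]

/-! ### Gradings, reality and nonvanishing of the vertex -/

lemma isWeightedHomogeneous_bracket (w : Fin 3 × Fin 2 → ℕ) (p q : Fin 3) (d : ℕ)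
    (h : w (p, 0) + w (q, 1) = d) (h' : w (p, 1) + w (q, 0) = d) :
    MvPolynomial.IsWeightedHomogeneous w (bracket p q) d := by
  refine .sub ?_ ?_
  · rw [← h]
    exact (MvPolynomial.isWeightedHomogeneous_X ℂ w _).mul
      (MvPolynomial.isWeightedHomogeneous_X ℂ w _)
  · rw [← h']
    exact (MvPolynomial.isWeightedHomogeneous_X ℂ w _).mul
      (MvPolynomial.isWeightedHomogeneous_X ℂ w _)

lemma isWeightedHomogeneous_vertexPoly (w : Fin 3 × Fin 2 → ℕ) (d : Fin 3 → Fin 3 → ℕ)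
    (h : ∀ p q, w (p, 0) + w (q, 1) = d p q) (h' : ∀ p q, w (p, 1) + w (q, 0) = d p q)
    (a b c : ℕ) :
    MvPolynomial.IsWeightedHomogeneous w (vertexPoly a b c)
      ((a + b - c) / 2 * d 0 1 + (b + c - a) / 2 * d 1 2 + (c + a - b) / 2 * d 2 0) := by
  have hb (p q : Fin 3) := isWeightedHomogeneous_bracket w p q _ (h p q) (h' p q)
  exact
    (((hb 0 1).pow ((a + b - c) / 2)).mul ((hb 1 2).pow ((b + c - a) / 2))).mul
      ((hb 2 0).pow ((c + a - b) / 2))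

lemma weight_eq_sum (w : Fin 3 × Fin 2 → ℕ) (s : Fin 3 × Fin 2 →₀ ℕ) :
    Finsupp.weight w s = ∑ p : Fin 3, (s (p, 0) * w (p, 0) + s (p, 1) * w (p, 1)) := by
  rw [Finsupp.weight_apply, Finsupp.sum_fintype _ _ (by simp), Fintype.sum_prod_type]
  simp [Fin.sum_univ_two]

/-- The components of the vertex vanish unless the weights of the legs sum to zero. -/
lemma add_eq_of_rawVertex_ne_zero {a b c α β γ : ℕ} (h : rawVertex a b c α β γ ≠ 0) :
    α + β + γ = (a + b + c) / 2 := by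
  unfold rawVertex at h
  split_ifs at h with had
  · have h1 := isWeightedHomogeneous_vertexPoly (fun s => if s.2 = 0 then 1 else 0)
      (fun _ _ => 1) (by simp) (by simp) a b c h
    rw [weight_eq_sum] at h1
    simp [Fin.sum_univ_three, exponent_apply_zero] at h1
    obtain ⟨h2, h3, h4, r, h5⟩ := had
    omega
  · exact absurd rfl h

lemma cartan_rawVertex (a b c : ℕ) : Annihilates₃ cartan a b c (rawVertex a b c) := by
  intro α hα β hβ γ hγ
  rw [sum_cartan hα, sum_cartan hβ (fun j => rawVertex a b c α j γ), sum_cartan hγ]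
  by_cases h : rawVertex a b c α β γ = 0
  · simp [h]
  · have h1 := add_eq_of_rawVertex_ne_zero h
    have had : Admissible a b c := by
      by_contra had
      exact h (by simp [rawVertex, had])
    obtain ⟨-, -, -, r, h5⟩ := had
    have h2 : 2 * (α + β + γ) = a + b + c := by omega
    have h3 : 2 * ((α : ℂ) + β + γ) = a + b + c := by exact_mod_cast h2
    linear_combination (rawVertex a b c α β γ) * h3

/-- The vertex polynomial has integer coefficients, so conjugating them changes nothing. -/
lemma conj_rawVertex (a b c α β γ : ℕ) :
    (starRingEnd ℂ) (rawVertex a b c α β γ) = rawVertex a b c α β γ := by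
  unfold rawVertex
  split_ifs
  · rw [← MvPolynomial.coeff_map]
    simp [vertexPoly, bracket]
  · simp

lemma bracket_ne_zero {p q : Fin 3} (h : p ≠ q) : bracket p q ≠ 0 := by
  intro h0
  -- At `x_p = y_q = 1` with all other variables zero, the bracket takes the value `1`.
  have := congrArg (MvPolynomial.eval fun s : Fin 3 × Fin 2 =>
    if s = (p, 0) ∨ s = (q, 1) then (1 : ℂ) else 0) h0
  simp [bracket, h, Ne.symm h] at this

lemma vertexPoly_ne_zero (a b c : ℕ) : vertexPoly a b c ≠ 0 :=
  mul_ne_zero (mul_ne_zero (pow_ne_zero _ (bracket_ne_zero (by decide)))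
    (pow_ne_zero _ (bracket_ne_zero (by decide)))) (pow_ne_zero _ (bracket_ne_zero (by decide)))

/-- A nonzero polynomial has a monomial. Grading by the degree in one leg at a time shows that this
monomial has degrees `a, b, c` in the three legs, so it is one of those recorded by `exponent`. -/
lemma exists_rawVertex_ne_zero {a b c : ℕ} (had : Admissible a b c) :
    ∃ α ≤ a, ∃ β ≤ b, ∃ γ ≤ c, rawVertex a b c α β γ ≠ 0 := by
  obtain ⟨s, hs⟩ := MvPolynomial.ne_zero_iff.1 (vertexPoly_ne_zero a b c)
  have hw (r : Fin 3) := isWeightedHomogeneous_vertexPoly (fun s => if s.1 = r then 1 else 0)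
    (fun p q => (if p = r then 1 else 0) + (if q = r then 1 else 0)) (by simp) (by simp) a b c hs
  have h0 := hw 0
  have h1 := hw 1
  have h2 := hw 2
  rw [weight_eq_sum] at h0 h1 h2
  simp [Fin.sum_univ_three] at h0 h1 h2
  have had' := had
  obtain ⟨i1, i2, i3, r, i4⟩ := had'
  refine ⟨s (0, 0), by omega, s (1, 0), by omega, s (2, 0), by omega, ?_⟩
  have : exponent ![a, b, c] ![s (0, 0), s (1, 0), s (2, 0)] = s := by
    ext ⟨p, i⟩
    fin_cases p <;> fin_cases i <;> simp [exponent] <;> omega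
  rw [rawVertex, if_pos had, this]
  exact hs

/-! ### Symmetries of the vertex -/

lemma rename_bracket (e : Fin 3 → Fin 3) (f : Fin 2 → Fin 2) (p q : Fin 3) :
    MvPolynomial.rename (Prod.map e f) (bracket p q) =
      MvPolynomial.X (e p, f 0) * MvPolynomial.X (e q, f 1) -
        MvPolynomial.X (e p, f 1) * MvPolynomial.X (e q, f 0) := by
  simp [bracket]

lemma bracket_swap (p q : Fin 3) : bracket p q = -bracket q p := by
  unfold bracket
  ring

lemma Admissible.half_add {a b c : ℕ} (h : Admissible a b c) :
    (a + b - c) / 2 + (b + c - a) / 2 + (c + a - b) / 2 = (a + b + c) / 2 := by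
  obtain ⟨h1, h2, h3, r, h4⟩ := h
  omega

lemma Admissible.reverse {a b c : ℕ} (h : Admissible a b c) : Admissible c b a := by
  obtain ⟨h1, h2, h3, r, h4⟩ := h
  exact ⟨by omega, by omega, by omega, r, by omega⟩

/-- Reversing the cyclic order of the legs. -/
lemma rawVertex_reverse (a b c α β γ : ℕ) :
    rawVertex c b a γ β α = (-1) ^ ((a + b + c) / 2) * rawVertex a b c α β γ := by
  by_cases had : Admissible a b c
  · rw [rawVertex, rawVertex, if_pos had, if_pos had.reverse]
    have hinj : Function.Injective (Prod.map (Fin.rev : Fin 3 → Fin 3) (id : Fin 2 → Fin 2)) :=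
      Fin.rev_injective.prodMap Function.injective_id
    -- Reversal turns each bracket into minus a bracket of the reversed vertex, and there are `(a +
    -- b + c) / 2` brackets in all.
    have hpoly : MvPolynomial.rename (Prod.map (Fin.rev : Fin 3 → Fin 3) (id : Fin 2 → Fin 2))
        (vertexPoly a b c) = (-1) ^ ((a + b + c) / 2) * vertexPoly c b a := by
      rw [vertexPoly, map_mul, map_mul, map_pow, map_pow, map_pow, rename_bracket,
        rename_bracket, rename_bracket, ← had.half_add, pow_add, pow_add, vertexPoly]
      have h1 : bracket 1 2 = -bracket 2 1 := bracket_swap _ _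
      have h2 : bracket 0 1 = -bracket 1 0 := bracket_swap _ _
      have h3 : bracket 2 0 = -bracket 0 2 := bracket_swap _ _
      rw [h1, h2, h3, neg_pow (bracket 2 1), neg_pow (bracket 1 0), neg_pow (bracket 0 2),
        show c + b - a = b + c - a by omega, show b + a - c = a + b - c by omega,
        show a + c - b = c + a - b by omega]
      simp only [bracket, show Fin.rev (0 : Fin 3) = 2 from rfl,
        show Fin.rev (1 : Fin 3) = 1 from rfl, show Fin.rev (2 : Fin 3) = 0 from rfl, id]
      ring_nf
      simp only [pow_mul', neg_one_sq, one_pow]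
      ring
    have hexp : (exponent ![a, b, c] ![α, β, γ]).mapDomain
        (Prod.map (Fin.rev : Fin 3 → Fin 3) (id : Fin 2 → Fin 2)) =
        exponent ![c, b, a] ![γ, β, α] := by
      ext ⟨p, i⟩
      have hp : ((p, i) : Fin 3 × Fin 2) =
          Prod.map (Fin.rev : Fin 3 → Fin 3) (id : Fin 2 → Fin 2) (Fin.rev p, i) := by simp
      rw [hp, Finsupp.mapDomain_apply hinj, ← hp]
      fin_cases p <;> fin_cases i <;> simp [exponent, Fin.rev]
    have h := MvPolynomial.coeff_rename_mapDomain _ hinj (vertexPoly a b c)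
      (exponent ![a, b, c] ![α, β, γ])
    rw [hpoly, hexp, show ((-1 : MvPolynomial (Fin 3 × Fin 2) ℂ)) ^ ((a + b + c) / 2) =
      MvPolynomial.C ((-1) ^ ((a + b + c) / 2)) by simp, MvPolynomial.coeff_C_mul] at h
    rw [← h, ← mul_assoc, ← mul_pow]
    simp
  · have had' : ¬ Admissible c b a := fun h => had h.reverse
    simp [rawVertex, had, had']

/-- Exchanging the two variables. -/
lemma rawVertex_sub {a b c α β γ : ℕ} (hα : α ≤ a) (hβ : β ≤ b) (hγ : γ ≤ c) :
    rawVertex a b c (a - α) (b - β) (c - γ) =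
      (-1) ^ ((a + b + c) / 2) * rawVertex a b c α β γ := by
  by_cases had : Admissible a b c
  · rw [rawVertex, rawVertex, if_pos had, if_pos had]
    have hinj : Function.Injective (Prod.map (id : Fin 3 → Fin 3) (Fin.rev : Fin 2 → Fin 2)) :=
      Function.injective_id.prodMap Fin.rev_injective
    have hpoly : MvPolynomial.rename (Prod.map (id : Fin 3 → Fin 3) (Fin.rev : Fin 2 → Fin 2))
        (vertexPoly a b c) = (-1) ^ ((a + b + c) / 2) * vertexPoly a b c := by
      have hb (p q : Fin 3) : MvPolynomial.rename
          (Prod.map (id : Fin 3 → Fin 3) (Fin.rev : Fin 2 → Fin 2)) (bracket p q) =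
          -bracket p q := by
        rw [rename_bracket]
        simp only [bracket, show Fin.rev (0 : Fin 2) = 1 from rfl,
          show Fin.rev (1 : Fin 2) = 0 from rfl, id]
        ring
      rw [vertexPoly, map_mul, map_mul, map_pow, map_pow, map_pow, hb, hb, hb,
        neg_pow (bracket 0 1), neg_pow (bracket 1 2), neg_pow (bracket 2 0),
        ← had.half_add, pow_add, pow_add]
      ring
    have hexp : (exponent ![a, b, c] ![α, β, γ]).mapDomain
        (Prod.map (id : Fin 3 → Fin 3) (Fin.rev : Fin 2 → Fin 2)) =
        exponent ![a, b, c] ![a - α, b - β, c - γ] := by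
      ext ⟨p, i⟩
      have hp : ((p, i) : Fin 3 × Fin 2) =
          Prod.map (id : Fin 3 → Fin 3) (Fin.rev : Fin 2 → Fin 2) (p, Fin.rev i) := by simp
      rw [hp, Finsupp.mapDomain_apply hinj, ← hp]
      fin_cases p <;> fin_cases i <;> simp [exponent, Fin.rev] <;> omega
    have h := MvPolynomial.coeff_rename_mapDomain _ hinj (vertexPoly a b c)
      (exponent ![a, b, c] ![α, β, γ])
    rw [hpoly, hexp, show ((-1 : MvPolynomial (Fin 3 × Fin 2) ℂ)) ^ ((a + b + c) / 2) =
      MvPolynomial.C ((-1) ^ ((a + b + c) / 2)) by simp, MvPolynomial.coeff_C_mul] at h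
    rw [← h, ← mul_assoc, ← mul_pow]
    simp
  · simp [rawVertex, had]

/-! ### The theta graph -/

lemma sum_form {n a : ℕ} (ha : a ≤ n) (f : ℕ → ℂ) :
    ∑ b ∈ Finset.range (n + 1), form n a b * f b =
      (-1) ^ (n - a) / (n.choose a : ℂ) * f (n - a) := by
  rw [Finset.sum_eq_single (n - a)]
  · rw [form, if_pos (by omega)]
  · intro b _ hb
    rw [form, if_neg (by omega), zero_mul]
  · intro h
    exact absurd (Finset.mem_range.2 (by omega)) h

/-- The absolute value of the theta graph. -/
def thetaAbs (a b c : ℕ) : ℝ :=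
  ∑ α ∈ Finset.range (a + 1), ∑ β ∈ Finset.range (b + 1), ∑ γ ∈ Finset.range (c + 1),
    (rawVertex a b c α β γ).re ^ 2 / (a.choose α * b.choose β * c.choose γ)

lemma rawVertex_re (a b c α β γ : ℕ) :
    ((rawVertex a b c α β γ).re : ℂ) = rawVertex a b c α β γ :=
  Complex.conj_eq_iff_re.1 (conj_rawVertex a b c α β γ)

lemma thetaAbs_pos {a b c : ℕ} (had : Admissible a b c) : 0 < thetaAbs a b c := by
  obtain ⟨α, hα, β, hβ, γ, hγ, h⟩ := exists_rawVertex_ne_zero had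
  have hre : (rawVertex a b c α β γ).re ≠ 0 := fun h0 => h (by
    rw [← rawVertex_re, h0, Complex.ofReal_zero])
  have h1 := Nat.choose_pos hα
  have h2 := Nat.choose_pos hβ
  have h3 := Nat.choose_pos hγ
  have hnn (α β γ : ℕ) :
      0 ≤ (rawVertex a b c α β γ).re ^ 2 / (a.choose α * b.choose β * c.choose γ : ℝ) :=
    div_nonneg (sq_nonneg _) (by positivity)
  have hpos : 0 < (rawVertex a b c α β γ).re ^ 2 / (a.choose α * b.choose β * c.choose γ : ℝ) :=
    div_pos (sq_pos_of_ne_zero hre) (by positivity)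
  exact Finset.sum_pos' (fun _ _ => Finset.sum_nonneg fun _ _ => Finset.sum_nonneg fun _ _ =>
      hnn _ _ _)
    ⟨α, Finset.mem_range.2 (by omega), Finset.sum_pos' (fun _ _ => Finset.sum_nonneg fun _ _ =>
      hnn _ _ _)
      ⟨β, Finset.mem_range.2 (by omega), Finset.sum_pos' (fun _ _ => hnn _ _ _)
        ⟨γ, Finset.mem_range.2 (by omega), hpos⟩⟩⟩

/-- The form pairs `α` only with `a - α`, so the primed sums collapse. The signs of
`rawVertex_reverse` and `rawVertex_sub` cancel each other, leaving a sum of squares times the signs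
of the three forms, whose product is constant on the support because the weights sum to zero. -/
lemma theta_eq {a b c : ℕ} (had : Admissible a b c) :
    theta a b c = (-1) ^ ((a + b + c) / 2) * (thetaAbs a b c : ℂ) := by
  rw [theta, thetaAbs]
  push_cast
  simp only [Finset.mul_sum]
  refine Finset.sum_congr rfl fun α hα => Finset.sum_congr rfl fun β hβ =>
    Finset.sum_congr rfl fun γ hγ => ?_
  have hα' : α ≤ a := by simpa [Nat.lt_succ_iff] using hα
  have hβ' : β ≤ b := by simpa [Nat.lt_succ_iff] using hβ
  have hγ' : γ ≤ c := by simpa [Nat.lt_succ_iff] using hγ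
  calc _ = rawVertex a b c α β γ * ∑ α' ∈ Finset.range (a + 1), form a α α' *
        ∑ β' ∈ Finset.range (b + 1), form b β β' *
          ∑ γ' ∈ Finset.range (c + 1), form c γ γ' * rawVertex c b a γ' β' α' := by
        simp only [Finset.mul_sum]
        refine Finset.sum_congr rfl fun _ _ => Finset.sum_congr rfl fun _ _ =>
          Finset.sum_congr rfl fun _ _ => ?_
        ring
    _ = _ := by
        simp only [sum_form hγ', sum_form hβ', sum_form hα',
          rawVertex_reverse a b c, rawVertex_sub hα' hβ' hγ', rawVertex_re a b c]
        by_cases h : rawVertex a b c α β γ = 0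
        · simp [h]
        · have h1 := add_eq_of_rawVertex_ne_zero h
          obtain ⟨-, -, -, r, h5⟩ := had
          have h2 : (-1 : ℂ) ^ (a - α) * (-1) ^ (b - β) * (-1) ^ (c - γ) =
              (-1) ^ ((a + b + c) / 2) := by
            rw [← pow_add, ← pow_add]
            congr 1
            omega
          have h3 : (-1 : ℂ) ^ ((a + b + c) / 2) * (-1) ^ ((a + b + c) / 2) = 1 := by
            rw [← mul_pow]
            simp
          rw [← h2] at h3 ⊢
          linear_combination (rawVertex a b c α β γ ^ 2 * (-1) ^ (a - α) * (-1) ^ (b - β) *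
            (-1) ^ (c - γ) / (a.choose α * b.choose β * c.choose γ)) * h3

lemma theta_ne_zero {a b c : ℕ} (had : Admissible a b c) : theta a b c ≠ 0 := by
  rw [theta_eq had]
  exact mul_ne_zero (pow_ne_zero _ (by norm_num))
    (Complex.ofReal_ne_zero.2 (thetaAbs_pos had).ne')

/-- The contraction of a tensor with three legs with itself. -/
def selfContraction (a b c : ℕ) (v : ℕ → ℕ → ℕ → ℂ) : ℂ :=
  ∑ α ∈ Finset.range (a + 1), ∑ β ∈ Finset.range (b + 1), ∑ γ ∈ Finset.range (c + 1),
  ∑ α' ∈ Finset.range (a + 1), ∑ β' ∈ Finset.range (b + 1), ∑ γ' ∈ Finset.range (c + 1),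
    v α β γ * v α' β' γ' * (form a α α' * form b β β' * form c γ γ')

lemma cpow_half_mul_self (z : ℂ) : z ^ (1 / 2 : ℂ) * z ^ (1 / 2 : ℂ) = z := by
  rw [← sq, one_div]
  exact_mod_cast Complex.cpow_nat_inv_pow z two_ne_zero

/-- The theta graph pairs the vertex with its reversal, whereas here both copies have the same
cyclic order; the discrepancy is the sign of `rawVertex_reverse`. -/
lemma selfContraction_vertex {a b c : ℕ} (had : Admissible a b c) :
    selfContraction a b c (vertex a b c) = (-1) ^ ((a + b + c) / 2) := by
  have h : selfContraction a b c (vertex a b c) =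
      (-1) ^ ((a + b + c) / 2) * theta a b c / theta a b c := by
    have hs := cpow_half_mul_self (theta a b c)
    rw [← hs]
    conv_rhs => rw [hs, theta]
    rw [selfContraction]
    simp only [Finset.mul_sum, Finset.sum_div]
    refine Finset.sum_congr rfl fun α _ => Finset.sum_congr rfl fun β _ =>
      Finset.sum_congr rfl fun γ _ => Finset.sum_congr rfl fun α' _ =>
      Finset.sum_congr rfl fun β' _ => Finset.sum_congr rfl fun γ' _ => ?_
    have h3 : (-1 : ℂ) ^ ((a + b + c) / 2) * (-1) ^ ((a + b + c) / 2) = 1 := by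
      rw [← mul_pow]
      simp
    rw [rawVertex_reverse a b c]
    simp only [vertex]
    rw [div_mul_div_comm, div_mul_eq_mul_div]
    congr 1
    linear_combination (-(rawVertex a b c α β γ * rawVertex a b c α' β' γ' *
      (form a α α' * form b β β' * form c γ γ'))) * h3
  rw [h, mul_div_assoc, div_self (theta_ne_zero had), mul_one]

/-! ### Invariant tensors with two legs -/

/-- A tensor with two legs is annihilated by the operator with components `D`. -/
def Annihilates₂ (D : ℕ → ℕ → ℕ → ℂ) (k l : ℕ) (f : ℕ → ℕ → ℂ) : Prop :=
  ∀ i ≤ k, ∀ j ≤ l,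
    ∑ r ∈ Finset.range (k + 1), D k i r * f r j +
    ∑ r ∈ Finset.range (l + 1), D l j r * f i r = 0

lemma Annihilates₂.swap {D : ℕ → ℕ → ℕ → ℂ} {k l : ℕ} {f : ℕ → ℕ → ℂ}
    (h : Annihilates₂ D k l f) : Annihilates₂ D l k fun i j => f j i := by
  intro i hi j hj
  rw [add_comm]
  exact h j hj i hi

lemma Annihilates₂.eq_zero_of_weight {k l : ℕ} {f : ℕ → ℕ → ℂ} (h : Annihilates₂ cartan k l f)
    {i j : ℕ} (hi : i ≤ k) (hj : j ≤ l) (hij : 2 * (i + j) ≠ k + l) : f i j = 0 := by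
  have h1 := h i hi j hj
  rw [sum_cartan hi (fun r => f r j), sum_cartan hj, ← add_mul] at h1
  refine (mul_eq_zero.1 h1).resolve_left fun h2 => hij ?_
  have : (2 * (i + j) : ℂ) = k + l := by linear_combination h2
  exact_mod_cast this

/-- Only the antidiagonal `2 * (i + j) = k + l` can be nonzero. As `k < l`, it has `j < l`, so the
raising equation may be used at `(i, j + 1)`. It expresses `f i j` through `f (i - 1) (j + 1)`, and
at `i = 0` it says `f 0 j = 0`. -/
lemma Annihilates₂.eq_zero_of_lt {k l : ℕ} {f : ℕ → ℕ → ℂ} (hE : Annihilates₂ raising k l f)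
    (hH : Annihilates₂ cartan k l f) (hkl : k < l) :
    ∀ i ≤ k, ∀ j ≤ l, f i j = 0 := by
  intro i
  induction i with
  | zero =>
    intro hi j hj
    by_cases hij : 2 * (0 + j) = k + l
    · have h := hE 0 hi (j + 1) (by omega)
      rw [sum_raising hi (fun r => f r (j + 1)), sum_raising (by omega)] at h
      simp only [if_true, Nat.add_eq_zero_iff, one_ne_zero, and_false, if_false,
        Nat.add_sub_cancel, zero_add] at h
      exact (mul_eq_zero.1 h).resolve_left (Nat.cast_add_one_ne_zero _)
    · exact hH.eq_zero_of_weight hi hj hij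
  | succ i ih =>
    intro hi j hj
    by_cases hij : 2 * (i + 1 + j) = k + l
    · have h := hE (i + 1) hi (j + 1) (by omega)
      rw [sum_raising hi (fun r => f r (j + 1)), sum_raising (by omega)] at h
      simp only [Nat.add_eq_zero_iff, one_ne_zero, and_false, if_false,
        Nat.add_sub_cancel] at h
      rw [ih (by omega) (j + 1) (by omega), mul_zero, zero_add] at h
      exact (mul_eq_zero.1 h).resolve_left (Nat.cast_add_one_ne_zero _)
    · exact hH.eq_zero_of_weight hi hj hij

lemma Annihilates₂.eq_zero_of_ne {k l : ℕ} {f : ℕ → ℕ → ℂ} (hE : Annihilates₂ raising k l f)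
    (hH : Annihilates₂ cartan k l f) (hkl : k ≠ l) {i j : ℕ} (hi : i ≤ k) (hj : j ≤ l) :
    f i j = 0 := by
  rcases lt_or_gt_of_ne hkl with h | h
  · exact hE.eq_zero_of_lt hH h i hi j hj
  · exact hE.swap.eq_zero_of_lt hH.swap h j hj i hi

/-- The components of the invariant tensor `[1 2] ^ n`. -/
def invariantPair (n i j : ℕ) : ℂ := if i + j = n then (-1) ^ j * (n.choose i : ℂ) else 0

lemma Annihilates₂.eq_smul {k : ℕ} {f : ℕ → ℕ → ℂ} (hE : Annihilates₂ raising k k f)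
    (hH : Annihilates₂ cartan k k f) :
    ∃ lam : ℂ, ∀ i ≤ k, ∀ j ≤ k, f i j = lam * invariantPair k i j := by
  -- The raising equation propagates along the antidiagonal from `f 0 k`; the sign compensates
  -- `invariantPair k 0 k = (-1) ^ k`.
  refine ⟨(-1) ^ k * f 0 k, fun i hi j hj => ?_⟩
  by_cases hij : i + j = k
  · obtain rfl : j = k - i := by omega
    rw [invariantPair, if_pos hij]
    clear hij hj
    induction i with
    | zero =>
      have h3 : (-1 : ℂ) ^ k * (-1) ^ k = 1 := by
        rw [← mul_pow]
        simp
      simp only [Nat.sub_zero, Nat.choose_zero_right, Nat.cast_one, mul_one]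
      linear_combination (-f 0 k) * h3
    | succ i ih =>
      have h := hE (i + 1) hi (k - i) (by omega)
      rw [sum_raising hi (fun r => f r (k - i)), sum_raising (by omega)] at h
      rw [if_neg (by omega), if_neg (by omega), Nat.add_sub_cancel, ih (by omega),
        show k - (k - i) = i by omega, show k - i - 1 = k - (i + 1) by omega] at h
      have hc : ((k.choose (i + 1) : ℂ)) * (i + 1) = k.choose i * ((k - (i + 1) : ℕ) + 1) := by
        have := Nat.choose_succ_right_eq k i
        rw [show k - i = k - (i + 1) + 1 by omega] at this
        exact_mod_cast this
      have hp : (-1 : ℂ) ^ (k - i) = -(-1) ^ (k - (i + 1)) := by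
        rw [show k - i = k - (i + 1) + 1 by omega, pow_succ]
        ring
      rw [hp] at h
      have hne : (i + 1 : ℂ) ≠ 0 := Nat.cast_add_one_ne_zero i
      apply mul_left_cancel₀ hne
      linear_combination h - ((-1) ^ k * f 0 k * (-1) ^ (k - (i + 1))) * hc
  · rw [invariantPair, if_neg hij, mul_zero]
    exact hH.eq_zero_of_weight hi hj (by omega)

/-! ### Matrices of invariant tensors -/

open Matrix
open scoped Kronecker

section Invariant

variable {I J K : Type*} [Fintype I] [Fintype J] [Fintype K]

/-- The tensor `X` is annihilated by the action of `D₁` and `D₂` on its two legs. -/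
def IsInvariant (D₁ : Matrix I I ℂ) (D₂ : Matrix J J ℂ) (X : Matrix I J ℂ) : Prop :=
  D₁ * X + X * D₂ᵀ = 0

/-- The bilinear form with matrix `G` is invariant under `D`. -/
def IsSkewFor (D G : Matrix I I ℂ) : Prop := Dᵀ * G + G * D = 0

lemma IsSkewFor.transpose {D G : Matrix I I ℂ} (h : IsSkewFor D G) : IsSkewFor D Gᵀ := by
  have := congrArg Matrix.transpose h
  simp only [transpose_add, transpose_mul, transpose_transpose, transpose_zero] at this
  rw [IsSkewFor, add_comm]
  exact this

lemma IsInvariant.transpose {D₁ : Matrix I I ℂ} {D₂ : Matrix J J ℂ} {X : Matrix I J ℂ}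
    (h : IsInvariant D₁ D₂ X) : IsInvariant D₂ D₁ Xᵀ := by
  have := congrArg Matrix.transpose h
  simp only [transpose_add, transpose_mul, transpose_transpose, transpose_zero] at this
  rw [IsInvariant, add_comm]
  exact this

/-- Contracting invariant tensors with an invariant form gives an invariant tensor. -/
lemma IsInvariant.contract {D₁ : Matrix I I ℂ} {D₂ : Matrix J J ℂ} {D₃ : Matrix K K ℂ}
    {X : Matrix I J ℂ} {G : Matrix J J ℂ} {Y : Matrix J K ℂ} (hX : IsInvariant D₁ D₂ X)
    (hG : IsSkewFor D₂ G) (hY : IsInvariant D₂ D₃ Y) : IsInvariant D₁ D₃ (X * G * Y) := by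
  unfold IsInvariant at *
  unfold IsSkewFor at hG
  have h1 : D₁ * X = -(X * D₂ᵀ) := eq_neg_of_add_eq_zero_left hX
  have h2 : Y * D₃ᵀ = -(D₂ * Y) := eq_neg_of_add_eq_zero_right hY
  have h3 : D₂ᵀ * G = -(G * D₂) := eq_neg_of_add_eq_zero_left hG
  calc D₁ * (X * G * Y) + X * G * Y * D₃ᵀ = D₁ * X * G * Y + X * G * (Y * D₃ᵀ) := by
        simp only [Matrix.mul_assoc]
    _ = -(X * (D₂ᵀ * G) * Y) + X * G * (Y * D₃ᵀ) := by
        rw [h1]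
        simp only [Matrix.mul_assoc, Matrix.neg_mul]
    _ = 0 := by
        rw [h2, h3]
        simp only [Matrix.mul_assoc, Matrix.neg_mul, Matrix.mul_neg, neg_neg, add_neg_cancel]

lemma IsSkewFor.kronecker [DecidableEq I] [DecidableEq J] {D₁ G₁ : Matrix I I ℂ}
    {D₂ G₂ : Matrix J J ℂ} (h₁ : IsSkewFor D₁ G₁) (h₂ : IsSkewFor D₂ G₂) :
    IsSkewFor (D₁ ⊗ₖ (1 : Matrix J J ℂ) + (1 : Matrix I I ℂ) ⊗ₖ D₂) (G₁ ⊗ₖ G₂) := by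
  unfold IsSkewFor at *
  have e : (D₁ ⊗ₖ (1 : Matrix J J ℂ) + (1 : Matrix I I ℂ) ⊗ₖ D₂)ᵀ * (G₁ ⊗ₖ G₂) +
      (G₁ ⊗ₖ G₂) * (D₁ ⊗ₖ (1 : Matrix J J ℂ) + (1 : Matrix I I ℂ) ⊗ₖ D₂) =
      (D₁ᵀ * G₁ + G₁ * D₁) ⊗ₖ G₂ + G₁ ⊗ₖ (D₂ᵀ * G₂ + G₂ * D₂) := by
    rw [transpose_add, ← kroneckerMap_transpose, ← kroneckerMap_transpose, transpose_one,
      transpose_one, Matrix.add_mul, Matrix.mul_add, ← mul_kronecker_mul, ← mul_kronecker_mul,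
      ← mul_kronecker_mul, ← mul_kronecker_mul, add_kronecker, kronecker_add]
    simp only [Matrix.one_mul, Matrix.mul_one]
    abel
  rw [e, h₁, h₂]
  simp

end Invariant

/-! ### The irreducible representations and Schur's lemma -/

/-- The matrix of an operator on the representation of spin `n / 2`. -/
def opMatrix (D : ℕ → ℕ → ℕ → ℂ) (n : ℕ) : Matrix (Fin (n + 1)) (Fin (n + 1)) ℂ :=
  Matrix.of fun i j => D n i j

/-- The matrix of the invariant form. -/
def formMatrix (n : ℕ) : Matrix (Fin (n + 1)) (Fin (n + 1)) ℂ :=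
  Matrix.of fun i j => form n i j

/-- The matrix of the invariant tensor with two legs. -/
def pairMatrix (n : ℕ) : Matrix (Fin (n + 1)) (Fin (n + 1)) ℂ :=
  Matrix.of fun i j => invariantPair n i j

lemma form_swap (n a b : ℕ) : form n b a = (-1) ^ n * form n a b := by
  unfold form
  by_cases h : a + b = n
  · rw [if_pos h, if_pos (by omega), ← Nat.choose_symm_of_eq_add (show n = a + b by omega),
      ← mul_div_assoc, ← h, ← pow_add, show a + b + b = a + 2 * b by ring, pow_add, pow_mul]
    simp
  · rw [if_neg h, if_neg (by omega), mul_zero]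

lemma formMatrix_mul_pairMatrix (n : ℕ) :
    formMatrix n * pairMatrix n = ((-1) ^ n : ℂ) • (1 : Matrix _ _ ℂ) := by
  ext i j
  have hi : (i : ℕ) ≤ n := by omega
  rw [Matrix.mul_apply, Matrix.smul_apply, Matrix.one_apply]
  simp only [formMatrix, pairMatrix, of_apply]
  rw [← Finset.sum_range (fun r => form n i r * invariantPair n r j), sum_form hi, invariantPair]
  by_cases h : i = j
  · subst h
    have hc : (n.choose i : ℂ) ≠ 0 := by exact_mod_cast (Nat.choose_pos hi).ne'
    rw [if_pos (by omega), if_pos rfl, Nat.choose_symm hi, smul_eq_mul, mul_one]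
    have : (-1 : ℂ) ^ n = (-1) ^ (n - (i : ℕ)) * (-1) ^ (i : ℕ) := by
      rw [← pow_add]
      congr 1
      omega
    rw [this]
    field_simp
  · have h' : (i : ℕ) ≠ j := fun e => h (Fin.ext e)
    rw [if_neg (by omega), if_neg h]
    simp

lemma pairMatrix_mul_formMatrix (n : ℕ) :
    pairMatrix n * formMatrix n = ((-1) ^ n : ℂ) • (1 : Matrix _ _ ℂ) := by
  have h : formMatrix n * (((-1) ^ n : ℂ) • pairMatrix n) = 1 := by
    rw [Matrix.mul_smul, formMatrix_mul_pairMatrix, smul_smul, ← mul_pow]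
    simp
  have h2 := mul_eq_one_comm.1 h
  rw [Matrix.smul_mul] at h2
  rw [← h2, smul_smul, ← mul_pow]
  simp

/-- The operator with components `D` preserves the invariant forms. -/
def PreservesForm (D : ℕ → ℕ → ℕ → ℂ) : Prop :=
  ∀ n i j : ℕ, i ≤ n → j ≤ n →
    D n (n - j) i * form n (n - j) j + form n i (n - i) * D n (n - i) j = 0

lemma preservesForm_raising : PreservesForm raising := by
  intro n i j hi hj
  unfold raising form
  rw [if_pos (show n - j + j = n by omega), if_pos (show i + (n - i) = n by omega)]
  by_cases h : i + 1 + j = n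
  · rw [if_pos (by omega), if_pos (by omega), show n - j = i + 1 by omega,
      show n - i = j + 1 by omega]
    have hc : ((n.choose (i + 1) : ℂ)) * (i + 1) = n.choose i * (n - i) := by
      have := Nat.choose_succ_right_eq n i
      rw [← Nat.cast_sub hi]
      exact_mod_cast this
    have h1 : (n.choose i : ℂ) ≠ 0 := by exact_mod_cast (Nat.choose_pos hi).ne'
    have h2 : (n.choose (i + 1) : ℂ) ≠ 0 := by
      exact_mod_cast (Nat.choose_pos (show i + 1 ≤ n by omega)).ne'
    have h3 : (n : ℂ) = i + 1 + j := by exact_mod_cast h.symm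
    have h4 : (n : ℂ) - j = i + 1 := by rw [h3]; ring
    rw [h4, pow_succ]
    field_simp
    linear_combination (-(-1) ^ j) * hc
  · rw [if_neg (by omega), if_neg (by omega)]
    simp

lemma preservesForm_cartan : PreservesForm cartan := by
  intro n i j hi hj
  unfold cartan form
  by_cases h : i + j = n
  · rw [if_pos (by omega), if_pos (by omega), if_pos (by omega), if_pos (by omega),
      show n - j = i by omega, show n - i = j by omega]
    have h3 : (n : ℂ) = i + j := by exact_mod_cast h.symm
    rw [h3]
    ring
  · rw [if_neg (by omega), if_neg (show ¬ n - i = j by omega)]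
    simp

/-- The form couples `i` only to `n - i`, so each matrix product has a single surviving term per
entry. -/
lemma PreservesForm.isSkewFor {D : ℕ → ℕ → ℕ → ℂ} (h : PreservesForm D) (n : ℕ) :
    IsSkewFor (opMatrix D n) (formMatrix n) := by
  unfold IsSkewFor
  ext i j
  have hi : (i : ℕ) ≤ n := by omega
  have hj : (j : ℕ) ≤ n := by omega
  have h1 (i' : ℕ) (f : ℕ → ℂ) (hi' : i' ≤ n) :
      ∑ r ∈ Finset.range (n + 1), f r * form n r i' = f (n - i') * form n (n - i') i' := by
    rw [Finset.sum_eq_single (n - i')]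
    · intro b _ hb
      rw [form, if_neg (by omega), mul_zero]
    · intro h
      exact absurd (Finset.mem_range.2 (by omega)) h
  have h2 (f : ℕ → ℂ) :
      ∑ r ∈ Finset.range (n + 1), form n i r * f r = form n i (n - i) * f (n - i) := by
    rw [Finset.sum_eq_single (n - (i : ℕ))]
    · intro b _ hb
      rw [form, if_neg (by omega), zero_mul]
    · intro h
      exact absurd (Finset.mem_range.2 (by omega)) h
  rw [Matrix.add_apply, Matrix.mul_apply, Matrix.mul_apply]
  simp only [opMatrix, formMatrix, transpose_apply, of_apply, Matrix.zero_apply]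
  rw [← Finset.sum_range (fun r => D n r i * form n r j),
    ← Finset.sum_range (fun r => form n i r * D n r j), h1 _ (fun r => D n r i) hj, h2]
  exact h n i j hi hj

lemma IsInvariant.annihilates₂ {D : ℕ → ℕ → ℕ → ℂ} {k l : ℕ}
    {X : Matrix (Fin (k + 1)) (Fin (l + 1)) ℂ} (h : IsInvariant (opMatrix D k) (opMatrix D l) X) :
    Annihilates₂ D k l fun i j => X (Fin.ofNat (k + 1) i) (Fin.ofNat (l + 1) j) := by
  intro i hi j hj
  have h1 := congrFun (congrFun h (Fin.ofNat (k + 1) i)) (Fin.ofNat (l + 1) j)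
  rw [Matrix.add_apply, Matrix.mul_apply, Matrix.mul_apply] at h1
  simp only [opMatrix, transpose_apply, of_apply, Matrix.zero_apply] at h1
  rw [Finset.sum_range, Finset.sum_range]
  simp only [Fin.ofNat_eq_cast, Fin.cast_val_eq_self]
  have ei : ((Fin.ofNat (k + 1) i : Fin (k + 1)) : ℕ) = i := Nat.mod_eq_of_lt (by omega)
  have ej : ((Fin.ofNat (l + 1) j : Fin (l + 1)) : ℕ) = j := Nat.mod_eq_of_lt (by omega)
  rw [ei, ej] at h1
  rw [← h1]
  congr 1
  exact Finset.sum_congr rfl fun _ _ => mul_comm _ _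

/-- Schur's lemma for inequivalent representations; the lowering operator is not needed. -/
lemma eq_zero_of_isInvariant {k l : ℕ} {X : Matrix (Fin (k + 1)) (Fin (l + 1)) ℂ} (hkl : k ≠ l)
    (hE : IsInvariant (opMatrix raising k) (opMatrix raising l) X)
    (hH : IsInvariant (opMatrix cartan k) (opMatrix cartan l) X) : X = 0 := by
  ext i j
  have := hE.annihilates₂.eq_zero_of_ne hH.annihilates₂ hkl (show (i : ℕ) ≤ k by omega)
    (show (j : ℕ) ≤ l by omega)
  simpa using this

lemma exists_eq_smul_pairMatrix {k : ℕ} {X : Matrix (Fin (k + 1)) (Fin (k + 1)) ℂ}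
    (hE : IsInvariant (opMatrix raising k) (opMatrix raising k) X)
    (hH : IsInvariant (opMatrix cartan k) (opMatrix cartan k) X) :
    ∃ lam : ℂ, X = lam • pairMatrix k := by
  obtain ⟨lam, h⟩ := hE.annihilates₂.eq_smul hH.annihilates₂
  refine ⟨lam, ?_⟩
  ext i j
  have := h i (by omega) j (by omega)
  simpa [pairMatrix] using this

/-! ### Decomposition of the tensor product of two representations -/

open Classical in
/-- The (doubled) spins that occur in the tensor product of two representations. -/
def channels (a b : ℕ) : Finset ℕ :=
  (Finset.range (a + b + 1)).filter fun k => Admissible a b k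

lemma mem_channels {a b k : ℕ} : k ∈ channels a b ↔ Admissible a b k := by
  simp only [channels, Finset.mem_filter, Finset.mem_range, and_iff_right_iff_imp]
  intro h
  have := h.2.2.1
  omega

/-- The channels are `b - a, b - a + 2, …, b + a`, so the dimensions form an arithmetic progression.
This is the Clebsch--Gordan dimension count used in `IsCoupling.completeness`. -/
lemma sum_channels_of_le {a b : ℕ} (h : a ≤ b) :
    ∑ k ∈ channels a b, (k + 1) = (a + 1) * (b + 1) := by
  have himg : channels a b = (Finset.range (a + 1)).image fun i => b - a + 2 * i := by
    ext k
    rw [mem_channels, Finset.mem_image]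
    constructor
    · rintro ⟨h1, h2, h3, r, h4⟩
      exact ⟨(k + a - b) / 2, Finset.mem_range.2 (by omega), by omega⟩
    · rintro ⟨i, hi, rfl⟩
      rw [Finset.mem_range] at hi
      exact ⟨by omega, by omega, by omega, b + i, by omega⟩
  rw [himg, Finset.sum_image (by intro i _ j _ hij; simpa using hij)]
  obtain ⟨d, rfl⟩ := Nat.exists_eq_add_of_le h
  have hsum (n : ℕ) : ∑ i ∈ Finset.range n, (d + 2 * i + 1) = n * (n + d) := by
    induction n with
    | zero => simp
    | succ n ih => rw [Finset.sum_range_succ, ih]; ring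
  rw [show a + d - a = d by omega, hsum]
  ring

lemma sum_channels (a b : ℕ) : ∑ k ∈ channels a b, (k + 1) = (a + 1) * (b + 1) := by
  rcases le_total a b with h | h
  · exact sum_channels_of_le h
  · have hs : channels a b = channels b a := by
      ext k
      rw [mem_channels, mem_channels]
      constructor
      · rintro ⟨h1, h2, h3, r, h4⟩
        exact ⟨by omega, by omega, by omega, r, by omega⟩
      · rintro ⟨h1, h2, h3, r, h4⟩
        exact ⟨by omega, by omega, by omega, r, by omega⟩
    rw [hs, sum_channels_of_le h, mul_comm]

/-- The matrix of an operator on the tensor product of two representations. -/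
def pairOp (D : ℕ → ℕ → ℕ → ℂ) (a b : ℕ) :
    Matrix (Fin (a + 1) × Fin (b + 1)) (Fin (a + 1) × Fin (b + 1)) ℂ :=
  opMatrix D a ⊗ₖ 1 + 1 ⊗ₖ opMatrix D b

/-- The matrix of the invariant form on the tensor product of two representations. -/
def pairForm (a b : ℕ) : Matrix (Fin (a + 1) × Fin (b + 1)) (Fin (a + 1) × Fin (b + 1)) ℂ :=
  formMatrix a ⊗ₖ formMatrix b

lemma PreservesForm.isSkewFor_pair {D : ℕ → ℕ → ℕ → ℂ} (h : PreservesForm D) (a b : ℕ) :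
    IsSkewFor (pairOp D a b) (pairForm a b) :=
  (h.isSkewFor a).kronecker (h.isSkewFor b)

/-- A family of invariant tensors `v k` coupling two representations to one of spin `k / 2`, whose
contractions with themselves are `N k`. -/
structure IsCoupling (a b : ℕ) (v : ∀ k, Matrix (Fin (a + 1) × Fin (b + 1)) (Fin (k + 1)) ℂ)
    (N : ℕ → ℂ) : Prop where
  raising : ∀ k ∈ channels a b, IsInvariant (pairOp raising a b) (opMatrix raising k) (v k)
  cartan : ∀ k ∈ channels a b, IsInvariant (pairOp cartan a b) (opMatrix cartan k) (v k)
  trace : ∀ k ∈ channels a b, ((v k)ᵀ * pairForm a b * v k * (formMatrix k)ᵀ).trace = N k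
  ne_zero : ∀ k ∈ channels a b, N k ≠ 0

section Coupling

variable {a b : ℕ} {v : ∀ k, Matrix (Fin (a + 1) × Fin (b + 1)) (Fin (k + 1)) ℂ} {N : ℕ → ℂ}

lemma IsCoupling.orthogonal (h : IsCoupling a b v N) {k l : ℕ} (hk : k ∈ channels a b)
    (hl : l ∈ channels a b) (hkl : k ≠ l) : (v k)ᵀ * pairForm a b * v l = 0 :=
  eq_zero_of_isInvariant hkl
    ((h.raising k hk).transpose.contract (preservesForm_raising.isSkewFor_pair a b)
      (h.raising l hl))
    ((h.cartan k hk).transpose.contract (preservesForm_cartan.isSkewFor_pair a b)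
      (h.cartan l hl))

lemma formMatrix_transpose (n : ℕ) : (formMatrix n)ᵀ = ((-1) ^ n : ℂ) • formMatrix n := by
  ext i j
  simp [formMatrix, form_swap n i j]

lemma neg_one_pow_mul_self (n : ℕ) : (-1 : ℂ) ^ n * (-1) ^ n = 1 := by
  rw [← mul_pow]
  simp

lemma pairMatrix_mul_formMatrix_transpose (n : ℕ) : pairMatrix n * (formMatrix n)ᵀ = 1 := by
  rw [formMatrix_transpose, Matrix.mul_smul, pairMatrix_mul_formMatrix, smul_smul,
    neg_one_pow_mul_self, one_smul]

/-- Schur's lemma makes the contraction a multiple of `pairMatrix k`; closing the remaining legs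
gives `k + 1` times the scalar, which must be `N k`. -/
lemma IsCoupling.self (h : IsCoupling a b v N) {k : ℕ} (hk : k ∈ channels a b) :
    (v k)ᵀ * pairForm a b * v k = (N k / (k + 1)) • pairMatrix k := by
  obtain ⟨lam, hlam⟩ := exists_eq_smul_pairMatrix
    ((h.raising k hk).transpose.contract (preservesForm_raising.isSkewFor_pair a b)
      (h.raising k hk))
    ((h.cartan k hk).transpose.contract (preservesForm_cartan.isSkewFor_pair a b)
      (h.cartan k hk))
  have ht := h.trace k hk
  rw [hlam, Matrix.smul_mul, pairMatrix_mul_formMatrix_transpose, trace_smul, trace_one,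
    Fintype.card_fin, smul_eq_mul] at ht
  have hne : (k + 1 : ℂ) ≠ 0 := Nat.cast_add_one_ne_zero k
  rw [hlam, ← ht]
  congr 1
  push_cast
  field_simp

/-- Placing the `v k` side by side gives a matrix `M` with an explicit left inverse `L`, by
orthogonality. By `sum_channels` its two index types have equal cardinality, so `L` is also a right
inverse, and `M * L = 1` is the claim. -/
lemma IsCoupling.completeness (h : IsCoupling a b v N) :
    ∑ k ∈ channels a b, ((-1) ^ k * (k + 1) / N k : ℂ) •
      (v k * formMatrix k * (v k)ᵀ * pairForm a b) = 1 := by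
  classical
  let M : Matrix (Fin (a + 1) × Fin (b + 1)) (Σ k : channels a b, Fin (k + 1)) ℂ :=
    Matrix.of fun p s => v s.1 p s.2
  let L : Matrix (Σ k : channels a b, Fin (k + 1)) (Fin (a + 1) × Fin (b + 1)) ℂ :=
    Matrix.of fun s p => ((-1) ^ (s.1 : ℕ) * ((s.1 : ℕ) + 1) / N s.1 : ℂ) *
      (formMatrix s.1 * (v s.1)ᵀ * pairForm a b) s.2 p
  have hLM : L * M = 1 := by
    ext ⟨⟨k, hk⟩, i⟩ ⟨⟨l, hl⟩, j⟩
    have hentry : (L * M) ⟨⟨k, hk⟩, i⟩ ⟨⟨l, hl⟩, j⟩ = ((-1) ^ k * (k + 1) / N k : ℂ) *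
        (formMatrix k * ((v k)ᵀ * pairForm a b * v l)) i j := by
      rw [← Matrix.mul_assoc, ← Matrix.mul_assoc, Matrix.mul_apply, Matrix.mul_apply,
        Finset.mul_sum]
      exact Finset.sum_congr rfl fun p _ => by simp [L, M, mul_assoc]
    rw [hentry]
    by_cases hkl : k = l
    · subst hkl
      have hne : (k + 1 : ℂ) ≠ 0 := Nat.cast_add_one_ne_zero k
      have hN := h.ne_zero k hk
      rw [h.self hk, Matrix.mul_smul, formMatrix_mul_pairMatrix, smul_smul, Matrix.smul_apply,
        smul_eq_mul, Matrix.one_apply, Matrix.one_apply]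
      by_cases hij : i = j
      · subst hij
        have hp := neg_one_pow_mul_self k
        simp only [if_true]
        field_simp
        linear_combination hp
      · rw [if_neg hij, if_neg (by simpa using hij), mul_zero, mul_zero]
    · rw [h.orthogonal hk hl hkl, Matrix.mul_zero, Matrix.one_apply, if_neg (by simp [hkl])]
      simp
  have hcard : Fintype.card (Σ k : channels a b, Fin (k + 1)) =
      Fintype.card (Fin (a + 1) × Fin (b + 1)) := by
    simp only [Fintype.card_sigma, Fintype.card_fin, Fintype.card_prod]
    rw [← sum_channels, Finset.sum_coe_sort (channels a b) fun k => k + 1]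
  have hML := (mul_eq_one_comm_of_equiv (Fintype.equivOfCardEq hcard)).1 hLM
  rw [← hML]
  ext p q
  rw [Matrix.mul_apply, Fintype.sum_sigma, Matrix.sum_apply, ← Finset.sum_coe_sort]
  refine Finset.sum_congr rfl fun k _ => ?_
  rw [Matrix.smul_apply, Matrix.mul_assoc, Matrix.mul_assoc, Matrix.mul_apply, smul_eq_mul,
    Finset.mul_sum]
  refine Finset.sum_congr rfl fun i _ => ?_
  simp only [M, L, Matrix.of_apply, Matrix.mul_assoc]
  ring

end Coupling

/-! ### Expansion and orthogonality in an intermediate channel -/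

section FourLegs

variable {a b c d : ℕ} {v : ∀ k, Matrix (Fin (a + 1) × Fin (b + 1)) (Fin (k + 1)) ℂ}
  {w : ∀ k, Matrix (Fin (c + 1) × Fin (d + 1)) (Fin (k + 1)) ℂ} {N N' : ℕ → ℂ}

/-- Every invariant tensor with four legs is a combination of those with an intermediate spin. -/
lemma IsCoupling.exists_expansion (hv : IsCoupling a b v N) (hw : IsCoupling c d w N')
    {T : Matrix (Fin (a + 1) × Fin (b + 1)) (Fin (c + 1) × Fin (d + 1)) ℂ}
    (hE : IsInvariant (pairOp SpinNetwork.raising a b) (pairOp SpinNetwork.raising c d) T)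
    (hH : IsInvariant (pairOp SpinNetwork.cartan a b) (pairOp SpinNetwork.cartan c d) T) :
    ∃ μ : ℕ → ℂ, T = ∑ k ∈ channels a b ∩ channels c d,
      μ k • (v k * formMatrix k * (w k)ᵀ) := by
  have hinv (k l : ℕ) (hk : k ∈ channels a b) (hl : l ∈ channels c d) :
      IsInvariant (opMatrix SpinNetwork.raising k) (opMatrix SpinNetwork.raising l)
        ((v k)ᵀ * pairForm a b * T * (pairForm c d)ᵀ * w l) ∧
      IsInvariant (opMatrix SpinNetwork.cartan k) (opMatrix SpinNetwork.cartan l)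
        ((v k)ᵀ * pairForm a b * T * (pairForm c d)ᵀ * w l) :=
    ⟨((((hv.raising k hk).transpose.contract (preservesForm_raising.isSkewFor_pair a b)
      hE)).contract (preservesForm_raising.isSkewFor_pair c d).transpose (hw.raising l hl)),
    ((((hv.cartan k hk).transpose.contract (preservesForm_cartan.isSkewFor_pair a b)
      hH)).contract (preservesForm_cartan.isSkewFor_pair c d).transpose (hw.cartan l hl))⟩
  have hex (k : ℕ) : ∃ lam : ℂ, k ∈ channels a b → k ∈ channels c d →
      (v k)ᵀ * pairForm a b * T * (pairForm c d)ᵀ * w k = lam • pairMatrix k := by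
    by_cases h : k ∈ channels a b ∧ k ∈ channels c d
    · obtain ⟨lam, hlam⟩ := exists_eq_smul_pairMatrix (hinv k k h.1 h.2).1 (hinv k k h.1 h.2).2
      exact ⟨lam, fun _ _ => hlam⟩
    · exact ⟨0, fun h1 h2 => absurd ⟨h1, h2⟩ h⟩
  choose lam hlam using hex
  refine ⟨fun k => ((-1) ^ k * (k + 1) / N k) * (((-1) ^ k * (k + 1) / N' k) * lam k), ?_⟩
  -- Insert a resolution of the identity on each side of `T`. The block between channels `k` and `l`
  -- is then an invariant tensor with two legs, so Schur's lemma leaves only `k = l`.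
  have hT : T = (∑ k ∈ channels a b, ((-1) ^ k * (k + 1) / N k : ℂ) •
      (v k * formMatrix k * (v k)ᵀ * pairForm a b)) * T *
      (∑ k ∈ channels c d, ((-1) ^ k * (k + 1) / N' k : ℂ) •
      (w k * formMatrix k * (w k)ᵀ * pairForm c d))ᵀ := by
    rw [hv.completeness, hw.completeness, transpose_one, Matrix.one_mul, Matrix.mul_one]
  have hterm (k l : ℕ) : (v k * formMatrix k * (v k)ᵀ * pairForm a b) * T *
      (w l * formMatrix l * (w l)ᵀ * pairForm c d)ᵀ =
      v k * formMatrix k * ((v k)ᵀ * pairForm a b * T * (pairForm c d)ᵀ * w l) *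
        (formMatrix l)ᵀ * (w l)ᵀ := by
    simp only [transpose_mul, transpose_transpose, Matrix.mul_assoc]
  conv_lhs => rw [hT]
  rw [Matrix.sum_mul, Matrix.sum_mul, ← Finset.filter_mem_eq_inter, Finset.sum_filter]
  refine Finset.sum_congr rfl fun k hk => ?_
  rw [transpose_sum, Matrix.mul_sum]
  simp only [transpose_smul, Matrix.smul_mul, Matrix.mul_smul, hterm]
  by_cases hk' : k ∈ channels c d
  · rw [if_pos hk', Finset.sum_eq_single k]
    · rw [hlam k hk hk', Matrix.mul_smul, Matrix.smul_mul, Matrix.smul_mul,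
        Matrix.mul_assoc (v k), formMatrix_mul_pairMatrix, formMatrix_transpose]
      simp only [Matrix.mul_smul, Matrix.smul_mul, smul_smul, Matrix.mul_one]
      congr 1
      have hp := neg_one_pow_mul_self k
      linear_combination (((-1) ^ k * (k + 1) / N k) * (((-1) ^ k * (k + 1) / N' k) * lam k)) * hp
    · intro l hl hlk
      rw [eq_zero_of_isInvariant (Ne.symm hlk) (hinv k l hk hl).1 (hinv k l hk hl).2]
      simp
    · exact fun h => absurd hk' h
  · rw [if_neg hk']
    refine Finset.sum_eq_zero fun l hl => ?_
    have hkl : k ≠ l := fun h => hk' (h ▸ hl)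
    rw [eq_zero_of_isInvariant hkl (hinv k l hk hl).1 (hinv k l hk hl).2]
    simp

/-- The pairing of two tensors with four legs. -/
def pairTrace (S T : Matrix (Fin (a + 1) × Fin (b + 1)) (Fin (c + 1) × Fin (d + 1)) ℂ) : ℂ :=
  (Sᵀ * pairForm a b * T * (pairForm c d)ᵀ).trace

lemma IsCoupling.pairTrace_of_ne (hv : IsCoupling a b v N) {k l : ℕ} (hk : k ∈ channels a b)
    (hl : l ∈ channels a b) (hkl : k ≠ l) :
    pairTrace (v k * formMatrix k * (w k)ᵀ) (v l * formMatrix l * (w l)ᵀ) = 0 := by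
  have e : (v k * formMatrix k * (w k)ᵀ)ᵀ * pairForm a b * (v l * formMatrix l * (w l)ᵀ) =
      w k * (formMatrix k)ᵀ * ((v k)ᵀ * pairForm a b * v l) * (formMatrix l * (w l)ᵀ) := by
    simp only [transpose_mul, transpose_transpose, Matrix.mul_assoc]
  rw [pairTrace, e, hv.orthogonal hk hl hkl]
  simp

/-- Contracting each half with its copy gives `N k / (k + 1)` and `N' k / (k + 1)`; the loop that
remains contributes the dimension `k + 1`. -/
lemma IsCoupling.pairTrace_self (hv : IsCoupling a b v N) (hw : IsCoupling c d w N') {k : ℕ}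
    (hk : k ∈ channels a b) (hk' : k ∈ channels c d) :
    pairTrace (v k * formMatrix k * (w k)ᵀ) (v k * formMatrix k * (w k)ᵀ) =
      N k * N' k / (k + 1) := by
  have hne : (k + 1 : ℂ) ≠ 0 := Nat.cast_add_one_ne_zero k
  have e : (v k * formMatrix k * (w k)ᵀ)ᵀ * pairForm a b * (v k * formMatrix k * (w k)ᵀ) *
        (pairForm c d)ᵀ =
      w k * ((formMatrix k)ᵀ * ((v k)ᵀ * pairForm a b * v k) * formMatrix k *
        ((w k)ᵀ * (pairForm c d)ᵀ)) := by
    simp only [transpose_mul, transpose_transpose, Matrix.mul_assoc]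
  have e2 : (w k)ᵀ * (pairForm c d)ᵀ * w k = (N' k / (k + 1)) • (pairMatrix k)ᵀ := by
    rw [← transpose_smul, ← hw.self hk']
    simp only [transpose_mul, transpose_transpose, Matrix.mul_assoc]
  have e3 : (formMatrix k)ᵀ * (pairMatrix k)ᵀ = ((-1) ^ k : ℂ) • (1 : Matrix _ _ ℂ) := by
    rw [← transpose_mul, pairMatrix_mul_formMatrix, transpose_smul, transpose_one]
  rw [pairTrace, e, trace_mul_comm, Matrix.mul_assoc, e2, hv.self hk]
  simp only [Matrix.mul_smul, Matrix.smul_mul, Matrix.mul_assoc]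
  rw [← Matrix.mul_assoc (pairMatrix k) (formMatrix k), pairMatrix_mul_formMatrix,
    Matrix.smul_mul, Matrix.one_mul, Matrix.mul_smul, e3]
  simp only [smul_smul, trace_smul, trace_one, Fintype.card_fin, smul_eq_mul]
  have hp := neg_one_pow_mul_self k
  push_cast
  field_simp
  linear_combination N k * N' k * hp

end FourLegs

/-! ### Invariant tensors with four legs -/

lemma trace_contract {I J : Type*} [Fintype I] [Fintype J] (X Y : Matrix I J ℂ)
    (G : Matrix I I ℂ) (F : Matrix J J ℂ) :
    (Xᵀ * G * Y * Fᵀ).trace =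
      ∑ i, ∑ j, ∑ i', ∑ j', X i j * Y i' j' * (G i i' * F j j') := by
  rw [Finset.sum_comm]
  simp only [Matrix.trace, Matrix.diag_apply, Matrix.mul_apply, Finset.sum_mul,
    Matrix.transpose_apply]
  refine Finset.sum_congr rfl fun j _ => ?_
  calc _ = ∑ j', ∑ i, ∑ i', X i j * G i i' * Y i' j' * F j j' :=
        Finset.sum_congr rfl fun _ _ => Finset.sum_comm
    _ = ∑ i, ∑ j', ∑ i', X i j * G i i' * Y i' j' * F j j' := Finset.sum_comm
    _ = ∑ i, ∑ i', ∑ j', X i j * G i i' * Y i' j' * F j j' :=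
        Finset.sum_congr rfl fun _ _ => Finset.sum_comm
    _ = _ := Finset.sum_congr rfl fun _ _ => Finset.sum_congr rfl fun _ _ =>
        Finset.sum_congr rfl fun _ _ => by ring

lemma pairOp_mul_apply {J : Type*} (D : ℕ → ℕ → ℕ → ℂ) (a b : ℕ)
    (X : Matrix (Fin (a + 1) × Fin (b + 1)) J ℂ) (p : Fin (a + 1) × Fin (b + 1)) (j : J) :
    (pairOp D a b * X) p j =
      ∑ r : Fin (a + 1), D a p.1 r * X (r, p.2) j + ∑ r : Fin (b + 1), D b p.2 r * X (p.1, r) j := by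
  rw [pairOp, Matrix.add_mul, Matrix.add_apply, Matrix.mul_apply, Matrix.mul_apply,
    Fintype.sum_prod_type, Fintype.sum_prod_type_right]
  simp [opMatrix, Matrix.one_apply]

/-- The vertex as a matrix with the first two legs as row index. -/
def vertexMatrix (a b k : ℕ) : Matrix (Fin (a + 1) × Fin (b + 1)) (Fin (k + 1)) ℂ :=
  Matrix.of fun p r => vertex a b k p.1 p.2 r

/-- The vertex as a matrix with the last two legs as row index. -/
def vertexMatrix' (a b k : ℕ) : Matrix (Fin (a + 1) × Fin (b + 1)) (Fin (k + 1)) ℂ :=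
  Matrix.of fun p r => vertex k a b r p.1 p.2

lemma isInvariant_vertexMatrix {D : ℕ → ℕ → ℕ → ℂ} {a b k : ℕ}
    (h : Annihilates₃ D a b k (vertex a b k)) :
    IsInvariant (pairOp D a b) (opMatrix D k) (vertexMatrix a b k) := by
  unfold IsInvariant
  ext p r
  rw [Matrix.add_apply, pairOp_mul_apply, Matrix.mul_apply]
  have := h p.1 (by omega) p.2 (by omega) r (by omega)
  rw [Finset.sum_range, Finset.sum_range, Finset.sum_range] at this
  simpa [vertexMatrix, opMatrix, mul_comm] using this

lemma isInvariant_vertexMatrix' {D : ℕ → ℕ → ℕ → ℂ} {a b k : ℕ}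
    (h : Annihilates₃ D k a b (vertex k a b)) :
    IsInvariant (pairOp D a b) (opMatrix D k) (vertexMatrix' a b k) := by
  unfold IsInvariant
  ext p r
  rw [Matrix.add_apply, pairOp_mul_apply, Matrix.mul_apply]
  have := h r (by omega) p.1 (by omega) p.2 (by omega)
  rw [Finset.sum_range, Finset.sum_range, Finset.sum_range] at this
  rw [add_assoc, add_comm] at this
  simpa [vertexMatrix', opMatrix, mul_comm] using this

lemma Admissible.rotate {a b k : ℕ} (h : Admissible a b k) : Admissible k a b := by
  obtain ⟨h1, h2, h3, r, h4⟩ := h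
  exact ⟨by omega, by omega, by omega, r, by omega⟩

lemma isCoupling_vertexMatrix (a b : ℕ) :
    IsCoupling a b (vertexMatrix a b) fun k => (-1) ^ ((a + b + k) / 2) where
  raising _ _ := isInvariant_vertexMatrix ((raising_rawVertex _ _ _).div _)
  cartan _ _ := isInvariant_vertexMatrix ((cartan_rawVertex _ _ _).div _)
  trace k hk := by
    rw [← selfContraction_vertex (mem_channels.1 hk), selfContraction, trace_contract]
    simp only [Finset.sum_range, Fintype.sum_prod_type]
    rfl
  ne_zero _ _ := pow_ne_zero _ (by norm_num)

lemma isCoupling_vertexMatrix' (a b : ℕ) :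
    IsCoupling a b (vertexMatrix' a b) fun k => (-1) ^ ((k + a + b) / 2) where
  raising _ _ := isInvariant_vertexMatrix' ((raising_rawVertex _ _ _).div _)
  cartan _ _ := isInvariant_vertexMatrix' ((cartan_rawVertex _ _ _).div _)
  trace k hk := by
    rw [← selfContraction_vertex (mem_channels.1 hk).rotate, selfContraction, trace_contract,
      Finset.sum_comm]
    simp only [Finset.sum_range, Fintype.sum_prod_type]
    refine Finset.sum_congr rfl fun r _ => Finset.sum_congr rfl fun p _ =>
      Finset.sum_congr rfl fun q _ => ?_
    calc _ = ∑ r' : Fin (k + 1), ∑ p' : Fin (a + 1), ∑ q' : Fin (b + 1),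
          vertexMatrix' a b k (p, q) r * vertexMatrix' a b k (p', q') r' *
            (pairForm a b (p, q) (p', q') * formMatrix k r r') := by
          exact (Finset.sum_congr rfl fun _ _ => Finset.sum_comm).trans Finset.sum_comm
      _ = _ := Finset.sum_congr rfl fun r' _ => Finset.sum_congr rfl fun p' _ =>
          Finset.sum_congr rfl fun q' _ => by
            simp only [vertexMatrix', pairForm, formMatrix, of_apply, kroneckerMap_apply]
            ring
  ne_zero _ _ := pow_ne_zero _ (by norm_num)

/-- The labels of the components of a tensor with four legs of spins `m l / 2`. -/
def box (m : Fin 4 → ℕ) : Finset (Fin 4 → ℕ) := Fintype.piFinset fun i => Finset.range (m i + 1)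

lemma mem_box {m x : Fin 4 → ℕ} : x ∈ box m ↔ ∀ i, x i ≤ m i := by
  simp [box]

lemma comp_mem_box {m x : Fin 4 → ℕ} (σ : Equiv.Perm (Fin 4)) (h : x ∈ box m) :
    x ∘ σ ∈ box (m ∘ σ) :=
  mem_box.2 fun i => mem_box.1 h (σ i)

lemma sum_box (m : Fin 4 → ℕ) (f : (Fin 4 → ℕ) → ℂ) :
    ∑ x ∈ box m, f x = ∑ p : Fin (m 0 + 1) × Fin (m 1 + 1),
      ∑ q : Fin (m 2 + 1) × Fin (m 3 + 1), f ![p.1, p.2, q.1, q.2] := by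
  rw [← Fintype.sum_prod_type']
  symm
  refine Finset.sum_bij (fun z _ => ![z.1.1, z.1.2, z.2.1, z.2.2]) ?_ ?_ ?_ ?_
  · intro z _
    rw [mem_box]
    intro i
    fin_cases i <;> simp <;> omega
  · rintro ⟨⟨a, b⟩, c, d⟩ _ ⟨⟨a', b'⟩, c', d'⟩ _ h
    have h0 := congrFun h 0
    have h1 := congrFun h 1
    have h2 := congrFun h 2
    have h3 := congrFun h 3
    simp [Fin.val_inj] at h0 h1 h2 h3
    simp [h0, h1, h2, h3]
  · intro x hx
    rw [mem_box] at hx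
    refine ⟨((⟨x 0, Nat.lt_succ_of_le (hx 0)⟩, ⟨x 1, Nat.lt_succ_of_le (hx 1)⟩),
      (⟨x 2, Nat.lt_succ_of_le (hx 2)⟩, ⟨x 3, Nat.lt_succ_of_le (hx 3)⟩)), Finset.mem_univ _, ?_⟩
    ext i
    fin_cases i <;> simp
  · intro _ _
    rfl

/-- A tensor with four legs as a matrix. -/
def toMatrix (m : Fin 4 → ℕ) (T : (Fin 4 → ℕ) → ℂ) :
    Matrix (Fin (m 0 + 1) × Fin (m 1 + 1)) (Fin (m 2 + 1) × Fin (m 3 + 1)) ℂ :=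
  Matrix.of fun p q => T ![p.1, p.2, q.1, q.2]

/-- A tensor with four legs is annihilated by the operator with components `D`. -/
def Annihilates₄ (D : ℕ → ℕ → ℕ → ℂ) (m : Fin 4 → ℕ) (T : (Fin 4 → ℕ) → ℂ) : Prop :=
  ∀ x ∈ box m, ∑ i, ∑ j ∈ Finset.range (m i + 1), D (m i) (x i) j * T (Function.update x i j) = 0

lemma isInvariant_toMatrix_apply (D : ℕ → ℕ → ℕ → ℂ) (m : Fin 4 → ℕ) (T : (Fin 4 → ℕ) → ℂ)
    (p : Fin (m 0 + 1) × Fin (m 1 + 1)) (q : Fin (m 2 + 1) × Fin (m 3 + 1)) :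
    (pairOp D (m 0) (m 1) * toMatrix m T + toMatrix m T * (pairOp D (m 2) (m 3))ᵀ) p q =
      ∑ i, ∑ j ∈ Finset.range (m i + 1),
        D (m i) ((![(p.1 : ℕ), (p.2 : ℕ), (q.1 : ℕ), (q.2 : ℕ)] : Fin 4 → ℕ) i) j *
          T (Function.update (![(p.1 : ℕ), (p.2 : ℕ), (q.1 : ℕ), (q.2 : ℕ)] : Fin 4 → ℕ) i j) := by
  have u0 (j : ℕ) : Function.update (![(p.1 : ℕ), (p.2 : ℕ), (q.1 : ℕ), (q.2 : ℕ)] : Fin 4 → ℕ) 0 j =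
      (![(j : ℕ), (p.2 : ℕ), (q.1 : ℕ), (q.2 : ℕ)] : Fin 4 → ℕ) := by
    ext i; fin_cases i <;> simp
  have u1 (j : ℕ) : Function.update (![(p.1 : ℕ), (p.2 : ℕ), (q.1 : ℕ), (q.2 : ℕ)] : Fin 4 → ℕ) 1 j =
      (![(p.1 : ℕ), (j : ℕ), (q.1 : ℕ), (q.2 : ℕ)] : Fin 4 → ℕ) := by
    ext i; fin_cases i <;> simp
  have u2 (j : ℕ) : Function.update (![(p.1 : ℕ), (p.2 : ℕ), (q.1 : ℕ), (q.2 : ℕ)] : Fin 4 → ℕ) 2 j =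
      (![(p.1 : ℕ), (p.2 : ℕ), (j : ℕ), (q.2 : ℕ)] : Fin 4 → ℕ) := by
    ext i; fin_cases i <;> simp
  have u3 (j : ℕ) : Function.update (![(p.1 : ℕ), (p.2 : ℕ), (q.1 : ℕ), (q.2 : ℕ)] : Fin 4 → ℕ) 3 j =
      (![(p.1 : ℕ), (p.2 : ℕ), (q.1 : ℕ), (j : ℕ)] : Fin 4 → ℕ) := by
    ext i; fin_cases i <;> simp
  have ht : toMatrix m T * (pairOp D (m 2) (m 3))ᵀ =
      (pairOp D (m 2) (m 3) * (toMatrix m T)ᵀ)ᵀ := by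
    rw [transpose_mul, transpose_transpose]
  rw [Matrix.add_apply, ht, Matrix.transpose_apply, pairOp_mul_apply, pairOp_mul_apply,
    Fin.sum_univ_four]
  simp only [u0, u1, u2, u3, Finset.sum_range]
  simp [toMatrix, add_assoc]

lemma annihilates₄_iff {D : ℕ → ℕ → ℕ → ℂ} {m : Fin 4 → ℕ} {T : (Fin 4 → ℕ) → ℂ} :
    Annihilates₄ D m T ↔
      IsInvariant (pairOp D (m 0) (m 1)) (pairOp D (m 2) (m 3)) (toMatrix m T) := by
  constructor
  · intro h
    unfold IsInvariant
    ext p q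
    rw [isInvariant_toMatrix_apply]
    refine h _ (mem_box.2 fun i => ?_)
    fin_cases i <;> simp <;> omega
  · intro h x hx
    have hx' := mem_box.1 hx
    have h1 := congrFun (congrFun h
      (⟨x 0, Nat.lt_succ_of_le (hx' 0)⟩, ⟨x 1, Nat.lt_succ_of_le (hx' 1)⟩))
      (⟨x 2, Nat.lt_succ_of_le (hx' 2)⟩, ⟨x 3, Nat.lt_succ_of_le (hx' 3)⟩)
    rw [isInvariant_toMatrix_apply] at h1
    have e : (![x 0, x 1, x 2, x 3] : Fin 4 → ℕ) = x := by
      ext i; fin_cases i <;> simp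
    simp only [e] at h1
    exact h1

/-- Together with `pairing_comp_perm`, this reduces an arbitrary splitting to the standard one. -/
lemma Annihilates₄.comp_perm {D : ℕ → ℕ → ℕ → ℂ} {m : Fin 4 → ℕ} (σ : Equiv.Perm (Fin 4))
    {T : (Fin 4 → ℕ) → ℂ} (h : Annihilates₄ D (m ∘ σ) T) :
    Annihilates₄ D m fun x => T (x ∘ σ) := by
  intro x hx
  rw [← Equiv.sum_comp σ, ← h (x ∘ σ) (comp_mem_box σ hx)]
  refine Finset.sum_congr rfl fun i _ => Finset.sum_congr rfl fun j _ => ?_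
  beta_reduce
  rw [Function.update_comp_equiv, Equiv.symm_apply_apply]
  rfl

/-- The invariant pairing of tensors with four legs. -/
def pairing (m : Fin 4 → ℕ) (S T : (Fin 4 → ℕ) → ℂ) : ℂ :=
  ∑ x ∈ box m, ∑ y ∈ box m, S x * T y * ∏ i, form (m i) (x i) (y i)

lemma pairing_eq_pairTrace (m : Fin 4 → ℕ) (S T : (Fin 4 → ℕ) → ℂ) :
    pairing m S T = pairTrace (toMatrix m S) (toMatrix m T) := by
  rw [pairing, pairTrace, trace_contract]
  simp only [sum_box]
  refine Finset.sum_congr rfl fun p _ => Finset.sum_congr rfl fun q _ =>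
    Finset.sum_congr rfl fun p' _ => Finset.sum_congr rfl fun q' _ => ?_
  rw [Fin.prod_univ_four]
  simp [toMatrix, pairForm, formMatrix, mul_assoc]

lemma pairing_comp_perm (m : Fin 4 → ℕ) (σ : Equiv.Perm (Fin 4)) (S T : (Fin 4 → ℕ) → ℂ) :
    pairing m (fun x => S (x ∘ σ)) (fun x => T (x ∘ σ)) = pairing (m ∘ σ) S T := by
  have hsum (f : (Fin 4 → ℕ) → ℂ) : ∑ x ∈ box (m ∘ σ), f x = ∑ x ∈ box m, f (x ∘ σ) := by
    symm
    refine Finset.sum_bij' (fun x _ => x ∘ σ) (fun x _ => x ∘ σ.symm)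
      (fun x hx => comp_mem_box σ hx) (fun x hx => ?_) (fun x _ => ?_) (fun x _ => ?_)
      (fun x _ => rfl)
    · have := comp_mem_box σ.symm hx
      rwa [Function.comp_assoc, Equiv.self_comp_symm, Function.comp_id] at this
    · rw [Function.comp_assoc, Equiv.self_comp_symm, Function.comp_id]
    · rw [Function.comp_assoc, Equiv.symm_comp_self, Function.comp_id]
  rw [pairing, pairing, hsum]
  refine Finset.sum_congr rfl fun x _ => ?_
  rw [hsum]
  refine Finset.sum_congr rfl fun y _ => ?_
  congr 1
  exact (Equiv.prod_comp σ fun i => form (m i) (x i) (y i)).symm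

lemma toMatrix_doubleY (m : Fin 4 → ℕ) (k : ℕ) :
    toMatrix m (doubleY m k) =
      vertexMatrix (m 0) (m 1) k * formMatrix k * (vertexMatrix' (m 2) (m 3) k)ᵀ := by
  ext p q
  simp only [Matrix.mul_apply, Finset.sum_mul, Matrix.transpose_apply, toMatrix, of_apply,
    doubleY, Finset.sum_range]
  rw [Finset.sum_comm]
  rfl

lemma mem_internalSpins {m : Fin 4 → ℕ} {k : ℕ} :
    k ∈ internalSpins m ↔ k ∈ channels (m 0) (m 1) ∧ k ∈ channels (m 2) (m 3) := by
  simp only [internalSpins, Finset.mem_filter, Finset.mem_range, mem_channels,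
    and_iff_right_iff_imp]
  intro h
  have := h.1.2.2.1
  omega

lemma internalSpins_eq (m : Fin 4 → ℕ) :
    internalSpins m = channels (m 0) (m 1) ∩ channels (m 2) (m 3) := by
  ext k
  rw [mem_internalSpins, Finset.mem_inter]

lemma annihilates₄_doubleY {D : ℕ → ℕ → ℕ → ℂ} (hD : PreservesForm D)
    (hv : ∀ a b c, Annihilates₃ D a b c (rawVertex a b c)) (m : Fin 4 → ℕ) (k : ℕ) :
    Annihilates₄ D m (doubleY m k) := by
  rw [annihilates₄_iff, toMatrix_doubleY]
  exact (isInvariant_vertexMatrix ((hv _ _ _).div _)).contract (hD.isSkewFor k)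
    (isInvariant_vertexMatrix' ((hv _ _ _).div _)).transpose

lemma exists_eq_sum_doubleY {m : Fin 4 → ℕ} {T : (Fin 4 → ℕ) → ℂ}
    (hE : Annihilates₄ raising m T) (hH : Annihilates₄ cartan m T) :
    ∃ μ : ℕ → ℂ, ∀ x ∈ box m, T x = ∑ k ∈ internalSpins m, μ k * doubleY m k x := by
  obtain ⟨μ, hμ⟩ := (isCoupling_vertexMatrix (m 0) (m 1)).exists_expansion
    (isCoupling_vertexMatrix' (m 2) (m 3)) (annihilates₄_iff.1 hE) (annihilates₄_iff.1 hH)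
  refine ⟨μ, fun x hx => ?_⟩
  have hx' := mem_box.1 hx
  have h1 := congrFun (congrFun hμ
    (⟨x 0, Nat.lt_succ_of_le (hx' 0)⟩, ⟨x 1, Nat.lt_succ_of_le (hx' 1)⟩))
    (⟨x 2, Nat.lt_succ_of_le (hx' 2)⟩, ⟨x 3, Nat.lt_succ_of_le (hx' 3)⟩)
  have e : (![x 0, x 1, x 2, x 3] : Fin 4 → ℕ) = x := by
    ext i; fin_cases i <;> simp
  rw [Matrix.sum_apply] at h1
  simp only [← toMatrix_doubleY, Matrix.smul_apply, toMatrix, of_apply, e, smul_eq_mul] at h1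
  rw [internalSpins_eq]
  exact h1

/-! ### Change of splitting -/

/-- The intertwiner `Y` for the splitting of the legs given by `σ`. -/
def splitY (σ : Equiv.Perm (Fin 4)) (m : Fin 4 → ℕ) (k : ℕ) (x : Fin 4 → ℕ) : ℂ :=
  doubleY (m ∘ σ) k (x ∘ σ)

lemma annihilates₄_splitY {D : ℕ → ℕ → ℕ → ℂ} (hD : PreservesForm D)
    (hv : ∀ a b c, Annihilates₃ D a b c (rawVertex a b c)) (σ : Equiv.Perm (Fin 4))
    (m : Fin 4 → ℕ) (k : ℕ) : Annihilates₄ D m (splitY σ m k) :=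
  (annihilates₄_doubleY hD hv (m ∘ σ) k).comp_perm σ

lemma comp_perm_symm (m : Fin 4 → ℕ) (σ : Equiv.Perm (Fin 4)) : (m ∘ σ) ∘ σ.symm = m := by
  rw [Function.comp_assoc, Equiv.self_comp_symm, Function.comp_id]

lemma exists_eq_sum_splitY (σ : Equiv.Perm (Fin 4)) {m : Fin 4 → ℕ} {T : (Fin 4 → ℕ) → ℂ}
    (hE : Annihilates₄ raising m T) (hH : Annihilates₄ cartan m T) :
    ∃ μ : ℕ → ℂ, ∀ x ∈ box m, T x = ∑ k ∈ internalSpins (m ∘ σ), μ k * splitY σ m k x := by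
  have hE' : Annihilates₄ raising (m ∘ σ) fun x => T (x ∘ σ.symm) :=
    Annihilates₄.comp_perm σ.symm (by rwa [comp_perm_symm])
  have hH' : Annihilates₄ cartan (m ∘ σ) fun x => T (x ∘ σ.symm) :=
    Annihilates₄.comp_perm σ.symm (by rwa [comp_perm_symm])
  obtain ⟨μ, hμ⟩ := exists_eq_sum_doubleY hE' hH'
  refine ⟨μ, fun x hx => ?_⟩
  have := hμ (x ∘ σ) (comp_mem_box σ hx)
  rwa [comp_perm_symm] at this

lemma pairing_splitY_of_ne (σ : Equiv.Perm (Fin 4)) {m : Fin 4 → ℕ} {k l : ℕ}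
    (hk : k ∈ internalSpins (m ∘ σ)) (hl : l ∈ internalSpins (m ∘ σ)) (hkl : k ≠ l) :
    pairing m (splitY σ m k) (splitY σ m l) = 0 := by
  refine (pairing_comp_perm m σ _ _).trans ?_
  rw [pairing_eq_pairTrace, toMatrix_doubleY, toMatrix_doubleY]
  exact (isCoupling_vertexMatrix _ _).pairTrace_of_ne (mem_internalSpins.1 hk).1
    (mem_internalSpins.1 hl).1 hkl

/-- The sign exponents of the two vertices, each half the sum of its three labels, add up to `(∑ i,
m i) / 2 + k`. Only `k` depends on the splitting, which explains the sign `(-1) ^ k` in the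
Barrett--Crane intertwiner. -/
lemma pairing_splitY_self (σ : Equiv.Perm (Fin 4)) {m : Fin 4 → ℕ} {k : ℕ}
    (hk : k ∈ internalSpins (m ∘ σ)) :
    pairing m (splitY σ m k) (splitY σ m k) = (-1) ^ ((∑ i, m i) / 2 + k) / (k + 1) := by
  refine (pairing_comp_perm m σ _ _).trans ?_
  obtain ⟨h1, h2⟩ := mem_internalSpins.1 hk
  rw [pairing_eq_pairTrace, toMatrix_doubleY, (isCoupling_vertexMatrix _ _).pairTrace_self
    (isCoupling_vertexMatrix' _ _) h1 h2, ← pow_add]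
  congr 2
  have hs : ∑ i, m i = ∑ i, (m ∘ σ) i := (Equiv.sum_comp σ m).symm
  rw [hs, Fin.sum_univ_four]
  obtain ⟨-, -, -, r, hr⟩ := mem_channels.1 h1
  obtain ⟨-, -, -, s, hs'⟩ := mem_channels.1 h2
  omega

lemma pairing_sum_left {m : Fin 4 → ℕ} {ι : Type*} {K : Finset ι} {S T : (Fin 4 → ℕ) → ℂ}
    {μ : ι → ℂ} {Y : ι → (Fin 4 → ℕ) → ℂ} (h : ∀ x ∈ box m, S x = ∑ k ∈ K, μ k * Y k x) :
    pairing m S T = ∑ k ∈ K, μ k * pairing m (Y k) T := by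
  simp only [pairing, Finset.mul_sum]
  symm
  rw [Finset.sum_comm]
  refine Finset.sum_congr rfl fun x hx => ?_
  rw [Finset.sum_comm]
  refine Finset.sum_congr rfl fun y _ => ?_
  rw [h x hx, Finset.sum_mul, Finset.sum_mul]
  exact Finset.sum_congr rfl fun _ _ => by ring

lemma pairing_sum_right {m : Fin 4 → ℕ} {ι : Type*} {K : Finset ι} {S T : (Fin 4 → ℕ) → ℂ}
    {μ : ι → ℂ} {Y : ι → (Fin 4 → ℕ) → ℂ} (h : ∀ x ∈ box m, T x = ∑ k ∈ K, μ k * Y k x) :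
    pairing m S T = ∑ k ∈ K, μ k * pairing m S (Y k) := by
  simp only [pairing, Finset.mul_sum]
  symm
  rw [Finset.sum_comm]
  refine Finset.sum_congr rfl fun x hx => ?_
  rw [Finset.sum_comm]
  refine Finset.sum_congr rfl fun y hy => ?_
  rw [h y hy, Finset.mul_sum, Finset.sum_mul]
  exact Finset.sum_congr rfl fun _ _ => by ring

/-- The Barrett--Crane intertwiner does not depend on the splitting used to write it down. -/
theorem barrettCrane_eq (σ τ : Equiv.Perm (Fin 4)) {m x x' : Fin 4 → ℕ} (hx : x ∈ box m)
    (hx' : x' ∈ box m) : barrettCrane σ m x x' = barrettCrane τ m x x' := by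
  have hex (ρ π : Equiv.Perm (Fin 4)) (l : ℕ) : ∃ μ : ℕ → ℂ, ∀ x ∈ box m,
      splitY π m l x = ∑ k ∈ internalSpins (m ∘ ρ), μ k * splitY ρ m k x :=
    exists_eq_sum_splitY ρ (annihilates₄_splitY preservesForm_raising raising_rawVertex π m l)
      (annihilates₄_splitY preservesForm_cartan cartan_rawVertex π m l)
  choose C hC using hex τ σ
  choose E hE using hex σ τ
  -- Here `C` expands the `σ` basis in the `τ` basis and `E` does the reverse. Computing the pairing
  -- of `splitY σ m l` with `splitY τ m k` through either expansion relates the two matrices.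
  have hCE (l : ℕ) (hl : l ∈ internalSpins (m ∘ σ)) (k : ℕ) (hk : k ∈ internalSpins (m ∘ τ)) :
      (-1) ^ l * ((l : ℂ) + 1) * C l k = (-1) ^ k * ((k : ℂ) + 1) * E k l := by
    have h1 := pairing_sum_left (T := splitY τ m k) (hC l)
    rw [Finset.sum_eq_single_of_mem k hk fun k' hk' hne => by
      rw [pairing_splitY_of_ne τ hk' hk hne, mul_zero], pairing_splitY_self τ hk] at h1
    have h2 := pairing_sum_right (S := splitY σ m l) (hE k)
    rw [Finset.sum_eq_single_of_mem l hl fun l' hl' hne => by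
      rw [pairing_splitY_of_ne σ hl hl' hne.symm, mul_zero], pairing_splitY_self σ hl, h1,
      pow_add, pow_add] at h2
    have hk1 : (k + 1 : ℂ) ≠ 0 := Nat.cast_add_one_ne_zero k
    have hl1 : (l + 1 : ℂ) ≠ 0 := Nat.cast_add_one_ne_zero l
    have hkp := neg_one_pow_mul_self k
    have hlp := neg_one_pow_mul_self l
    have hmp := neg_one_pow_mul_self ((∑ i, m i) / 2)
    generalize (-1 : ℂ) ^ ((∑ i, m i) / 2) = s at *
    generalize (-1 : ℂ) ^ k = u at *
    generalize (-1 : ℂ) ^ l = w at *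
    field_simp at h2
    have h3 : C l k * u * (l + 1) = w * (k + 1) * E k l := by
      linear_combination s * h2 - (C l k * u * (l + 1) - w * (k + 1) * E k l) * hmp
    linear_combination u * w * h3 - w * (l + 1) * C l k * hkp + u * (k + 1) * E k l * hlp
  have hexp (ρ : Equiv.Perm (Fin 4)) : barrettCrane ρ m x x' =
      ∑ k ∈ internalSpins (m ∘ ρ), (-1) ^ k * ((k : ℂ) + 1) *
        (splitY ρ m k x * splitY ρ m k x') := rfl
  rw [hexp, hexp]
  -- Expand the right factor in the `τ` basis, exchange coefficients by `hCE`, and resum the left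
  -- factor.
  calc _ = ∑ l ∈ internalSpins (m ∘ σ), ∑ k ∈ internalSpins (m ∘ τ),
        (-1) ^ l * ((l : ℂ) + 1) * C l k * (splitY σ m l x * splitY τ m k x') := by
        refine Finset.sum_congr rfl fun l _ => ?_
        rw [hC l x' hx', Finset.mul_sum, Finset.mul_sum]
        exact Finset.sum_congr rfl fun _ _ => by ring
    _ = ∑ k ∈ internalSpins (m ∘ τ), ∑ l ∈ internalSpins (m ∘ σ),
        (-1) ^ k * ((k : ℂ) + 1) * E k l * (splitY σ m l x * splitY τ m k x') := by
        rw [Finset.sum_comm]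
        exact Finset.sum_congr rfl fun k hk => Finset.sum_congr rfl fun l hl => by
          rw [hCE l hl k hk]
    _ = _ := by
        refine Finset.sum_congr rfl fun k _ => ?_
        rw [hE k x hx, Finset.sum_mul, Finset.mul_sum]
        exact Finset.sum_congr rfl fun _ _ => by ring

/-! ### The `10j` symbols -/

/-- The labellings of the ends of the edges. -/
def labellings (n : Edge → ℕ) : Finset (Edge → ℕ) :=
  Fintype.piFinset fun e => Finset.range (n e + 1)

lemma legs_mem_box {n t h : Edge → ℕ} (ht : t ∈ labellings n) (hh : h ∈ labellings n)
    (i : ZMod 5) : legs t h i ∈ box (legs n n i) := by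
  have ht' (e : Edge) : t e ≤ n e := by
    have := Fintype.mem_piFinset.1 ht e
    rw [Finset.mem_range] at this
    omega
  have hh' (e : Edge) : h e ≤ n e := by
    have := Fintype.mem_piFinset.1 hh e
    rw [Finset.mem_range] at this
    omega
  rw [mem_box]
  intro l
  fin_cases l
  · exact ht' _
  · exact ht' _
  · exact hh' _
  · exact hh' _

lemma evaluate_eq_mul {n : Edge → ℕ} {B B' : ZMod 5 → Tensor} (s : ZMod 5 → ℂ)
    (h : ∀ i, ∀ x ∈ box (legs n n i), ∀ x' ∈ box (legs n n i), B i x x' = s i * B' i x x') :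
    evaluate n B = (∏ i, s i) * evaluate n B' := by
  change ∑ t ∈ labellings n, ∑ h ∈ labellings n, ∑ t' ∈ labellings n, ∑ h' ∈ labellings n, _ =
    _ * ∑ t ∈ labellings n, ∑ h ∈ labellings n, ∑ t' ∈ labellings n, ∑ h' ∈ labellings n, _
  simp only [Finset.mul_sum]
  refine Finset.sum_congr rfl fun t ht => Finset.sum_congr rfl fun h₁ hh =>
    Finset.sum_congr rfl fun t' ht' => Finset.sum_congr rfl fun h₁' hh' => ?_
  have e : ∏ i, B i (legs t h₁ i) (legs t' h₁' i) =
      (∏ i, s i) * ∏ i, B' i (legs t h₁ i) (legs t' h₁' i) := by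
    rw [← Finset.prod_mul_distrib]
    exact Finset.prod_congr rfl fun i _ =>
      h i _ (legs_mem_box ht hh i) _ (legs_mem_box ht' hh' i)
  rw [e, mul_left_comm]

/-- Admissibility makes `m 0 + m 1 + k` even, so `(-1) ^ k` is the same for all intermediate spins.
-/
lemma barrettCrane_one_eq (m x x' : Fin 4 → ℕ) :
    barrettCrane 1 m x x' = (-1) ^ (m 0 + m 1) * modifiedBarrettCrane 1 m x x' := by
  rw [barrettCrane, modifiedBarrettCrane, Finset.mul_sum]
  refine Finset.sum_congr rfl fun k hk => ?_
  obtain ⟨-, -, -, r, hr⟩ := mem_channels.1 (mem_internalSpins.1 hk).1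
  simp only [Function.comp_apply, Equiv.Perm.one_apply] at hr
  have hs : (-1 : ℂ) ^ k = (-1) ^ (m 0 + m 1) := by
    have h1 := neg_one_pow_mul_self k
    have h2 := neg_one_pow_mul_self r
    rw [← pow_add, ← hr, pow_add] at h2
    linear_combination (-(-1 : ℂ) ^ k) * h2 + (-1) ^ (m 0 + m 1) * h1
  rw [hs, mul_assoc]

lemma sum_edges (n : Edge → ℕ) : ∑ e, n e = ∑ i, (n (i, 0) + n (i, 1)) := by
  rw [Fintype.sum_prod_type]
  exact Finset.sum_congr rfl fun i _ => Fin.sum_univ_two _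

/-- Legs `0` and `1` at the vertex `i` are the edges with tail `i`, so the product of the vertex
signs counts each edge once. -/
theorem tenJ_eq (σ : ZMod 5 → Equiv.Perm (Fin 4)) (n : Edge → ℕ) :
    tenJ σ n = (-1) ^ (∑ e, n e) * modifiedTenJ n := by
  rw [tenJ, modifiedTenJ, sum_edges, ← Finset.prod_pow_eq_pow_sum]
  refine evaluate_eq_mul _ fun i x hx x' hx' => ?_
  rw [barrettCrane_eq (σ i) 1 hx hx', barrettCrane_one_eq]
  rfl

/-! ### Positivity of the modified symbol -/

/-- The value of the `SU(2)` network with the intertwiners `y i` at the vertices. -/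
def network (n : Edge → ℕ) (y : ZMod 5 → (Fin 4 → ℕ) → ℂ) : ℂ :=
  ∑ t ∈ labellings n, ∑ h ∈ labellings n, (∏ e, form (n e) (t e) (h e)) * ∏ i, y i (legs t h i)

/-- Distribute the product over vertices across the sums over intermediate spins. With these fixed,
the sums for the left and right factors are independent and equal. -/
lemma modifiedTenJ_eq (n : Edge → ℕ) :
    modifiedTenJ n = ∑ κ ∈ Fintype.piFinset fun i => internalSpins (legs n n i),
      (∏ i, ((κ i : ℂ) + 1)) * (network n (fun i => doubleY (legs n n i) (κ i)) *
        network n (fun i => doubleY (legs n n i) (κ i))) := by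
  change ∑ t ∈ labellings n, ∑ h ∈ labellings n, ∑ t' ∈ labellings n, ∑ h' ∈ labellings n,
    (∏ e, form (n e) (t e) (h e) * form (n e) (t' e) (h' e)) *
      ∏ i, ∑ k ∈ internalSpins (legs n n i), ((k : ℂ) + 1) *
        (doubleY (legs n n i) k (legs t h i) * doubleY (legs n n i) k (legs t' h' i)) = _
  simp only [network, Finset.prod_univ_sum, Finset.sum_mul]
  simp only [Finset.mul_sum]
  symm
  rw [Finset.sum_comm]
  refine Finset.sum_congr rfl fun t _ => ?_
  rw [Finset.sum_comm]
  refine Finset.sum_congr rfl fun h _ => ?_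
  rw [Finset.sum_comm]
  refine Finset.sum_congr rfl fun t' _ => ?_
  rw [Finset.sum_comm]
  refine Finset.sum_congr rfl fun h' _ => Finset.sum_congr rfl fun κ _ => ?_
  simp only [Finset.prod_mul_distrib]
  ring

/-- The intertwiner `Y` made of unnormalized vertices. -/
def rawDoubleY (m : Fin 4 → ℕ) (k : ℕ) (x : Fin 4 → ℕ) : ℂ :=
  ∑ c ∈ Finset.range (k + 1), ∑ d ∈ Finset.range (k + 1),
    rawVertex (m 0) (m 1) k (x 0) (x 1) c * form k c d *
      rawVertex k (m 2) (m 3) d (x 2) (x 3)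

/-- The normalization of the intertwiner `Y`. -/
def normalization (m : Fin 4 → ℕ) (k : ℕ) : ℂ :=
  theta (m 0) (m 1) k ^ (1 / 2 : ℂ) * theta k (m 2) (m 3) ^ (1 / 2 : ℂ)

lemma doubleY_eq_div (m : Fin 4 → ℕ) (k : ℕ) (x : Fin 4 → ℕ) :
    doubleY m k x = rawDoubleY m k x / normalization m k := by
  simp only [doubleY, rawDoubleY, normalization, vertex, Finset.sum_div]
  refine Finset.sum_congr rfl fun c _ => Finset.sum_congr rfl fun d _ => ?_
  rw [div_mul_eq_mul_div, div_mul_div_comm]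

lemma normalization_mul_self (m : Fin 4 → ℕ) (k : ℕ) :
    normalization m k * normalization m k = theta (m 0) (m 1) k * theta k (m 2) (m 3) := by
  rw [normalization, mul_mul_mul_comm, cpow_half_mul_self, cpow_half_mul_self]

lemma network_div (n : Edge → ℕ) (y : ZMod 5 → (Fin 4 → ℕ) → ℂ) (s : ZMod 5 → ℂ) :
    network n (fun i x => y i x / s i) = network n y / ∏ i, s i := by
  simp only [network, Finset.prod_div_distrib, Finset.sum_div, mul_div_assoc]

lemma conj_form (n a b : ℕ) : (starRingEnd ℂ) (form n a b) = form n a b := by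
  unfold form
  split_ifs <;> simp

lemma conj_network_rawDoubleY (n : Edge → ℕ) (κ : ZMod 5 → ℕ) :
    (starRingEnd ℂ) (network n fun i => rawDoubleY (legs n n i) (κ i)) =
      network n fun i => rawDoubleY (legs n n i) (κ i) := by
  simp only [network, rawDoubleY, map_sum, map_mul, map_prod, conj_form, conj_rawVertex]

/-- Unnormalized vertices and forms are real, so only the normalization could spoil the sign. Its
square is a product of ten theta graphs, so the choice of roots disappears and only the signs of the
theta graphs matter. -/
lemma exists_network_sq (n : Edge → ℕ) (κ : ZMod 5 → ℕ)
    (hκ : ∀ i, κ i ∈ internalSpins (legs n n i)) :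
    ∃ r : ℝ, 0 ≤ r ∧ network n (fun i => doubleY (legs n n i) (κ i)) *
      network n (fun i => doubleY (legs n n i) (κ i)) = r := by
  obtain ⟨z, hz⟩ := Complex.conj_eq_iff_real.1 (conj_network_rawDoubleY n κ)
  have hY : network n (fun i => doubleY (legs n n i) (κ i)) =
      z / ∏ i, normalization (legs n n i) (κ i) := by
    rw [← hz, ← network_div]
    congr 1
    ext i x
    exact doubleY_eq_div _ _ _
  have had (i : ZMod 5) : Admissible (n (i, 0)) (n (i, 1)) (κ i) ∧
      Admissible (κ i) (n (i - 2, 1)) (n (i - 1, 0)) := by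
    obtain ⟨h1, h2⟩ := mem_internalSpins.1 (hκ i)
    exact ⟨mem_channels.1 h1, (mem_channels.1 h2).rotate⟩
  let τ : ZMod 5 → ℝ := fun i => thetaAbs (n (i, 0)) (n (i, 1)) (κ i) *
    thetaAbs (κ i) (n (i - 2, 1)) (n (i - 1, 0))
  let J : ZMod 5 → ℕ := fun i => (n (i, 0) + n (i, 1) + κ i) / 2 +
    (κ i + n (i - 2, 1) + n (i - 1, 0)) / 2
  have hnorm (i : ZMod 5) : normalization (legs n n i) (κ i) * normalization (legs n n i) (κ i) =
      (-1) ^ J i * (τ i : ℂ) := by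
    rw [normalization_mul_self]
    change theta (n (i, 0)) (n (i, 1)) (κ i) * theta (κ i) (n (i - 2, 1)) (n (i - 1, 0)) = _
    rw [theta_eq (had i).1, theta_eq (had i).2]
    simp only [J, τ]
    push_cast
    ring
  -- Each edge meets two vertices and each intermediate edge two trivalent ones, so the half-sums
  -- total `∑ i, (n (i, 0) + n (i, 1) + κ i)`, every term of which is even by admissibility.
  have hJ : Even (∑ i, J i) := by
    have h1 (i : ZMod 5) : 2 * J i = (n (i, 0) + n (i, 1)) + n (i - 2, 1) + n (i - 1, 0) +
        2 * κ i := by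
      obtain ⟨-, -, -, r, hr⟩ := (had i).1
      obtain ⟨-, -, -, s, hs⟩ := (had i).2
      simp only [J]
      omega
    have h2 : 2 * ∑ i, J i = 2 * ∑ i, (n (i, 0) + n (i, 1)) + 2 * ∑ i, κ i := by
      have e1 : ∑ i : ZMod 5, n (i - 2, 1) = ∑ i, n (i, 1) :=
        Equiv.sum_comp (Equiv.subRight (2 : ZMod 5)) fun i => n (i, 1)
      have e2 : ∑ i : ZMod 5, n (i - 1, 0) = ∑ i, n (i, 0) :=
        Equiv.sum_comp (Equiv.subRight (1 : ZMod 5)) fun i => n (i, 0)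
      rw [Finset.mul_sum, Finset.sum_congr rfl fun i _ => h1 i]
      simp only [Finset.sum_add_distrib, e1, e2, ← Finset.mul_sum]
      ring
    have h3 : ∑ i, J i = ∑ i, ((n (i, 0) + n (i, 1)) + κ i) := by
      have e : ∑ i, ((n (i, 0) + n (i, 1)) + κ i) = ∑ i, (n (i, 0) + n (i, 1)) + ∑ i, κ i :=
        Finset.sum_add_distrib
      exact Nat.eq_of_mul_eq_mul_left two_pos (by rw [h2, e, mul_add])
    rw [h3]
    exact Finset.even_sum _ fun i _ => (had i).1.2.2.2
  have hτ (i : ZMod 5) : 0 < τ i := mul_pos (thetaAbs_pos (had i).1) (thetaAbs_pos (had i).2)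
  refine ⟨z * z / ∏ i, τ i, div_nonneg (mul_self_nonneg z)
    (Finset.prod_nonneg fun i _ => (hτ i).le), ?_⟩
  rw [hY, div_mul_div_comm, ← Finset.prod_mul_distrib,
    Finset.prod_congr rfl fun i _ => hnorm i, Finset.prod_mul_distrib,
    Finset.prod_pow_eq_pow_sum, hJ.neg_one_pow, one_mul]
  push_cast
  rfl

theorem exists_modifiedTenJ_eq (n : Edge → ℕ) : ∃ r : ℝ, 0 ≤ r ∧ modifiedTenJ n = r := by
  rw [modifiedTenJ_eq]
  -- The membership condition is put inside the existential so that `choose` yields a function of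
  -- `κ` alone; the value `0` for other `κ` is never used.
  have h (κ : ZMod 5 → ℕ) : ∃ r : ℝ, (∀ i, κ i ∈ internalSpins (legs n n i)) →
      0 ≤ r ∧ network n (fun i => doubleY (legs n n i) (κ i)) *
        network n (fun i => doubleY (legs n n i) (κ i)) = r := by
    by_cases hκ : ∀ i, κ i ∈ internalSpins (legs n n i)
    · obtain ⟨r, hr⟩ := exists_network_sq n κ hκ
      exact ⟨r, fun _ => hr⟩
    · exact ⟨0, fun h => absurd h hκ⟩
  choose r hr using h
  refine ⟨∑ κ ∈ Fintype.piFinset fun i => internalSpins (legs n n i),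
    (∏ i, ((κ i : ℝ) + 1)) * r κ, Finset.sum_nonneg fun κ hκ =>
      mul_nonneg (Finset.prod_nonneg fun _ _ => by positivity)
        (hr κ (Fintype.mem_piFinset.1 hκ)).1, ?_⟩
  push_cast
  exact Finset.sum_congr rfl fun κ hκ => by rw [(hr κ (Fintype.mem_piFinset.1 hκ)).2]

end SpinNetwork

end

theorem lemma4 (σ : ZMod 5 → Equiv.Perm (Fin 4)) (n : SpinNetwork.Edge → ℕ) :
    SpinNetwork.tenJ σ n = (-1) ^ (∑ e, n e) * SpinNetwork.modifiedTenJ n ∧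
    (SpinNetwork.tenJ σ n ≠ 0 →
      ((∃ z : ℤ, ∑ e, SpinNetwork.spin (n e) = z) →
        ∃ r : ℝ, 0 < r ∧ SpinNetwork.tenJ σ n = r) ∧
      ((∃ z : ℤ, ∑ e, SpinNetwork.spin (n e) = z + 1 / 2) →
        ∃ r : ℝ, r < 0 ∧ SpinNetwork.tenJ σ n = r)) := by
  have h := SpinNetwork.tenJ_eq σ n
  obtain ⟨r, hr, hmod⟩ := SpinNetwork.exists_modifiedTenJ_eq n
  have hspin : ∑ e, SpinNetwork.spin (n e) = ((∑ e, n e : ℕ) : ℚ) / 2 := by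
    simp only [SpinNetwork.spin]
    rw [← Finset.sum_div, Nat.cast_sum]
  refine ⟨h, fun hne => ?_⟩
  rw [h, hmod] at hne ⊢
  -- The modified symbol is only known to be nonnegative; the nonvanishing of the `10j` symbol makes
  -- it positive.
  have hr' : 0 < r := lt_of_le_of_ne hr fun h0 => hne (by rw [← h0]; simp)
  constructor
  · rintro ⟨z, hz⟩
    have heven : Even (∑ e, n e) := by
      have h1 : ((∑ e, n e : ℕ) : ℚ) = 2 * z := by linear_combination 2 * (hz - hspin)
      have h2 : ((∑ e, n e : ℕ) : ℤ) = 2 * z := by exact_mod_cast h1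
      exact Nat.even_iff.2 (by omega)
    exact ⟨r, hr', by rw [heven.neg_one_pow, one_mul]⟩
  · rintro ⟨z, hz⟩
    have hodd : Odd (∑ e, n e) := by
      have h1 : ((∑ e, n e : ℕ) : ℚ) = 2 * z + 1 := by linear_combination 2 * (hz - hspin)
      have h2 : ((∑ e, n e : ℕ) : ℤ) = 2 * z + 1 := by exact_mod_cast h1
      exact Nat.odd_iff.2 (by omega)
    exact ⟨-r, by linarith, by rw [hodd.neg_one_pow]; simp⟩
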